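/- Let $(\overline M,\overline g_0,\overline J)$ be an indefinite Kähler manifold of real dimension $2m$, $m>1$: $\overline g_0$ is a pseudo-Riemannian metric, $\overline J^2=-1$, $\overline g_0(\overline J\cdot,\overline J\cdot)=\overline g_0$, and $\overline J$ is parallel for the Levi-Civita connection $\overline\nabla$. Let $M$ be a lightlike real hypersurface of $\overline M$ (an immersed hypersurface whose normal spaces satisfy $TM^\perp\subset TM$), with induced degenerate metric $g_0$. Let $S(TM)$ be a screen distribution, that is, a smooth distribution with $TM=S(TM)\oplus TM^\perp$, and let $P$ be the projection of $TM$ onto $S(TM)$ along $TM^\perp$. On an open set $\mathcal U\subset M$ let $\{\xi,N\}$ be a normalizing pair: $\xi$ is a smooth section of $TM^\perp$, $N$ is a smooth section of $T\overline M|_M$, and $\overline g_0(N,\xi)=1$, $\overline g_0(N,N)=0$, $\overline g_0(N,W)=0$ for all $W\in S(TM)$. Let $tr(TM)$ be the line bundle spanned by $N$, so that $T\overline M|_M=TM\oplus tr(TM)$. Assume that $\overline J(TM^\perp)\oplus\overline J(tr(TM))\subset S(TM)$. Let $D^{g_0}$ be the induced connection on $M$, and define $B$, $A_N$, $\stackrel{\star}{A}_\xi$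 and $\varphi_{g_0}$ by $$\overline\nabla_XY=D^{g_0}_XY+B(X,Y)N,\qquad \overline\nabla_XN=-A_NX+\tau(X)N,\qquad D^{g_0}_X\xi=-\stackrel{\star}{A}_\xi X+\varphi_{g_0}(X)\xi,$$ where $D^{g_0}_XY$ and $A_NX$ are tangent to $M$ and $\stackrel{\star}{A}_\xi X=-P(D^{g_0}_X\xi)\in S(TM)$. Put $U=-\overline JN$, $V=-\overline J\xi$, $\theta_0(X)=g_0(X,V)$. Let $D_0$ be the $g_0$-orthogonal complement of $\overline J(TM^\perp)\oplus\overline J(tr(TM))$ in $S(TM)$, let $\Delta=\overline J(TM^\perp)\oplus TM^\perp\oplus D_0$, let $\sigma$ be the projection of $TM=\Delta\oplus\overline J(tr(TM))$ onto $\Delta$, and $F=\overline J\circ\sigma$. Let $\theta_0^\sharp$ be the vector field dual to $\theta_0$ under the isomorphism $X\mapsto g_0(X,\cdot)+\eta(X)\eta$, where $\eta=\overline g_0(N,\cdot)$. Then for all smooth vector fields $X,Y$ tangent to $M$ on $\mathcal U$: (i) $(D^{g_0}_X\theta_0)(Y)=\theta_0(Y)\varphi_{g_0}(X)-B(X,FY)$;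 (ii) $(D^{g_0}_XF)(Y)=\theta_0(Y)A_NX-B(X,Y)U$; (iii) $\varphi_{g_0}(X)=-\theta_0(D^{g_0}_XU)$; (iv) $D^{g_0}_X\theta_0^\sharp=F(\stackrel{\star}{A}_\xi X)+\varphi_{g_0}(X)\theta_0^\sharp$. If moreover $M$ is totally geodesic ($\overline\nabla_XY$ is tangent to $M$ for all vector fields $X,Y$ tangent to $M$), then $D^{g_0}_X\theta_0=\varphi_{g_0}(X)\theta_0$ and $D^{g_0}_X\theta_0^\sharp=\varphi_{g_0}(X)\theta_0^\sharp$. -/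

import Mathlib

open Bundle Manifold
open scoped ContDiff

namespace LightlikeKahler

noncomputable section

/-! ## The ambient indefinite Kähler manifold -/

section Ambient

/-- A smooth pseudo-Riemannian metric (of arbitrary signature) on a manifold `Mb` without boundary
modelled on `E`. -/
structure PseudoRiemannianMetric (E : Type*) [NormedAddCommGroup E] [NormedSpace ℝ E]
    (Mb : Type*) [TopologicalSpace Mb] [ChartedSpace E Mb] [IsManifold 𝓘(ℝ, E) ∞ Mb] where
  /-- The bilinear form on each tangent space. -/
  inner (x : Mb) : TangentSpace 𝓘(ℝ, E) x →L[ℝ] TangentSpace 𝓘(ℝ, E) x →L[ℝ] ℝ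
  symm (x : Mb) (v w : TangentSpace 𝓘(ℝ, E) x) : inner x v w = inner x w v
  nondegenerate (x : Mb) (v : TangentSpace 𝓘(ℝ, E) x) (hv : ∀ w, inner x v w = 0) :
    v = 0
  contMDiff : ContMDiff 𝓘(ℝ, E) (𝓘(ℝ, E).prod 𝓘(ℝ, E →L[ℝ] E →L[ℝ] ℝ)) ∞
    (fun x ↦ TotalSpace.mk' (E →L[ℝ] E →L[ℝ] ℝ)
      (E := fun x : Mb ↦ TangentSpace 𝓘(ℝ, E) x →L[ℝ] TangentSpace 𝓘(ℝ, E) x →L[ℝ] ℝ)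
      x (inner x))

/-- A smooth almost complex structure: a smooth field of endomorphisms of the tangent spaces with
square `-1`. -/
structure AlmostComplexStructure (E : Type*) [NormedAddCommGroup E] [NormedSpace ℝ E]
    (Mb : Type*) [TopologicalSpace Mb] [ChartedSpace E Mb] [IsManifold 𝓘(ℝ, E) ∞ Mb] where
  /-- The endomorphism of each tangent space. -/
  toFun (x : Mb) : TangentSpace 𝓘(ℝ, E) x →L[ℝ] TangentSpace 𝓘(ℝ, E) x
  sq (x : Mb) (v : TangentSpace 𝓘(ℝ, E) x) : toFun x (toFun x v) = -v
  contMDiff : ContMDiff 𝓘(ℝ, E) (𝓘(ℝ, E).prod 𝓘(ℝ, E →L[ℝ] E)) ∞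
    (fun x ↦ TotalSpace.mk' (E →L[ℝ] E)
      (E := fun x : Mb ↦ TangentSpace 𝓘(ℝ, E) x →L[ℝ] TangentSpace 𝓘(ℝ, E) x) x (toFun x))

variable {E : Type*} [NormedAddCommGroup E] [NormedSpace ℝ E] [FiniteDimensional ℝ E]
  {Mb : Type*} [TopologicalSpace Mb] [ChartedSpace E Mb] [IsManifold 𝓘(ℝ, E) ∞ Mb]

/-- `cov` is the Levi-Civita connection of `g`: it is torsion-free and
`v (g (Y, Z)) = g (∇_v Y, Z) + g (Y, ∇_v Z)`. Here `cov Y x v` is `(∇_v Y) x`. -/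
def IsLeviCivita (g : PseudoRiemannianMetric E Mb)
    (cov : CovariantDerivative 𝓘(ℝ, E) E (TangentSpace 𝓘(ℝ, E) : Mb → Type _)) : Prop :=
  cov.torsion = 0 ∧
  ∀ (Y Z : Π x : Mb, TangentSpace 𝓘(ℝ, E) x) (x : Mb) (v : TangentSpace 𝓘(ℝ, E) x),
    MDifferentiableAt 𝓘(ℝ, E) 𝓘(ℝ, E).tangent
      (fun y ↦ (⟨y, Y y⟩ : TangentBundle 𝓘(ℝ, E) Mb)) x →
    MDifferentiableAt 𝓘(ℝ, E) 𝓘(ℝ, E).tangent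
      (fun y ↦ (⟨y, Z y⟩ : TangentBundle 𝓘(ℝ, E) Mb)) x →
    mvfderiv 𝓘(ℝ, E) (fun y ↦ g.inner y (Y y) (Z y)) x v =
      g.inner x (cov Y x v) (Z x) + g.inner x (Y x) (cov Z x v)

/-- `g` is Hermitian with respect to `J`. -/
def IsHermitian (g : PseudoRiemannianMetric E Mb) (J : AlmostComplexStructure E Mb) : Prop :=
  ∀ (x : Mb) (v w : TangentSpace 𝓘(ℝ, E) x),
    g.inner x (J.toFun x v) (J.toFun x w) = g.inner x v w

/-- `J` is parallel: `(∇_v J) Y = ∇_v (J Y) - J (∇_v Y) = 0`. -/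
def IsParallel (cov : CovariantDerivative 𝓘(ℝ, E) E (TangentSpace 𝓘(ℝ, E) : Mb → Type _))
    (J : AlmostComplexStructure E Mb) : Prop :=
  ∀ (Y : Π x : Mb, TangentSpace 𝓘(ℝ, E) x) (x : Mb) (v : TangentSpace 𝓘(ℝ, E) x),
    MDifferentiableAt 𝓘(ℝ, E) 𝓘(ℝ, E).tangent
      (fun y ↦ (⟨y, Y y⟩ : TangentBundle 𝓘(ℝ, E) Mb)) x →
    cov (fun y ↦ J.toFun y (Y y)) x v = J.toFun x (cov Y x v)

/-- `(Mb, g, J)` is an (indefinite) Kähler manifold with Levi-Civita connection `cov`. -/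
structure IsKahler (g : PseudoRiemannianMetric E Mb) (J : AlmostComplexStructure E Mb)
    (cov : CovariantDerivative 𝓘(ℝ, E) E (TangentSpace 𝓘(ℝ, E) : Mb → Type _)) : Prop where
  leviCivita : IsLeviCivita g cov
  hermitian : IsHermitian g J
  parallel : IsParallel cov J

end Ambient

/-- The linear projection of `V` onto `A` along `B`, for complementary subspaces `A` and `B`
(and `0` if they are not complementary). -/
def projAlong {V : Type*} [AddCommGroup V] [Module ℝ V] (A B : Submodule ℝ V) : V →ₗ[ℝ] V :=
  open scoped Classical in if h : IsCompl A B then A.projection B h else 0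

/-! ## Lightlike hypersurfaces -/

section Hypersurface

variable {E : Type*} [NormedAddCommGroup E] [NormedSpace ℝ E] [FiniteDimensional ℝ E]
  {Mb : Type*} [TopologicalSpace Mb] [ChartedSpace E Mb] [IsManifold 𝓘(ℝ, E) ∞ Mb]
  {E' : Type*} [NormedAddCommGroup E'] [NormedSpace ℝ E'] [FiniteDimensional ℝ E']
  {M : Type*} [TopologicalSpace M] [ChartedSpace E' M] [IsManifold 𝓘(ℝ, E') ∞ M]

/-- The differential of `i : M → Mb` at `p`, as a linear map `T_p M → T_{i p} Mb`. -/
def di (i : M → Mb) (p : M) : TangentSpace 𝓘(ℝ, E') p →ₗ[ℝ] TangentSpace 𝓘(ℝ, E) (i p) :=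
  (mfderiv 𝓘(ℝ, E') 𝓘(ℝ, E) i p).toLinearMap

/-- `X` is a smooth vector field on the subset `𝒰` of `M`. -/
def SmoothField (𝒰 : Set M) (X : Π p : M, TangentSpace 𝓘(ℝ, E') p) : Prop :=
  ContMDiffOn 𝓘(ℝ, E') 𝓘(ℝ, E').tangent ∞ (fun p ↦ (⟨p, X p⟩ : TangentBundle 𝓘(ℝ, E') M)) 𝒰

/-- `Y` is, on `𝒰`, a smooth vector field along `i`, i.e. a smooth section of the restriction
of `T Mb` to `M`. -/
def SmoothFieldAlong (i : M → Mb) (𝒰 : Set M) (Y : Π p : M, TangentSpace 𝓘(ℝ, E) (i p)) : Prop :=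
  ContMDiffOn 𝓘(ℝ, E') 𝓘(ℝ, E).tangent ∞ (fun p ↦ (⟨i p, Y p⟩ : TangentBundle 𝓘(ℝ, E) Mb)) 𝒰

/-- The covariant derivative `∇̄_v Y` at `p` of a vector field `Y` along `i : M → Mb` in the
direction `v ∈ T_p M`. In the local trivialization of `T Mb` around `i p`, write
`Y q = ∑ yᵃ(q) Eₐ(i q)` with `Eₐ` the associated frame; then
`∇̄_v Y = ∑ dyᵃ(v) Eₐ(i p) + yᵃ(p) ∇̄_{di v} Eₐ`. The vector field `∑ yᵃ(p) Eₐ` is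
`FiberBundle.extend E (Y p)`. -/
def covAlong (cov : CovariantDerivative 𝓘(ℝ, E) E (TangentSpace 𝓘(ℝ, E) : Mb → Type _))
    (i : M → Mb) (Y : Π q : M, TangentSpace 𝓘(ℝ, E) (i q)) (p : M)
    (v : TangentSpace 𝓘(ℝ, E') p) : TangentSpace 𝓘(ℝ, E) (i p) :=
  let e := trivializationAt E (TangentSpace 𝓘(ℝ, E) : Mb → Type _) (i p)
  e.symmL ℝ (i p)
      (mvfderiv 𝓘(ℝ, E') (fun q ↦ e.continuousLinearMapAt ℝ (i q) (Y q)) p v) +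
    cov (FiberBundle.extend E (Y p)) (i p) (di i p v)

/-- The induced (possibly degenerate) metric `g₀ (u, v) = ḡ (di u, di v)`. -/
def inducedMetric (g : PseudoRiemannianMetric E Mb) (i : M → Mb) (p : M)
    (u v : TangentSpace 𝓘(ℝ, E') p) : ℝ :=
  g.inner (i p) (di i p u) (di i p v)

/-- The normal space `T_p M^⊥ ⊆ T_{i p} Mb`. -/
def normalSpace (g : PseudoRiemannianMetric E Mb) (i : M → Mb) (p : M) :
    Submodule ℝ (TangentSpace 𝓘(ℝ, E) (i p)) where
  carrier := {w | ∀ v : TangentSpace 𝓘(ℝ, E') p, g.inner (i p) w (di i p v) = 0}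
  add_mem' {a b} ha hb v := by
    rw [map_add, add_apply, ha v, hb v, add_zero]
  zero_mem' v := by rw [map_zero, zero_apply]
  smul_mem' c a ha v := by
    rw [map_smul, smul_apply, ha v, smul_zero]

/-- `i : M → Mb` is a smooth immersion whose normal spaces are contained in the tangent spaces.
When `M` has codimension one this says that `M` is a lightlike hypersurface. -/
structure IsLightlike (g : PseudoRiemannianMetric E Mb) (i : M → Mb) : Prop where
  contMDiff : ContMDiff 𝓘(ℝ, E') 𝓘(ℝ, E) ∞ i
  injective (p : M) : Function.Injective (di (E := E) (E' := E') i p)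
  normal_le (p : M) :
    normalSpace (E' := E') g i p ≤ LinearMap.range (di (E := E) (E' := E') i p)

/-- The normal (= radical) distribution `TM^⊥`, viewed inside `TM`. -/
def radical (g : PseudoRiemannianMetric E Mb) (i : M → Mb) (p : M) :
    Submodule ℝ (TangentSpace 𝓘(ℝ, E') p) :=
  (normalSpace (E' := E') g i p).comap (di i p)

/-- `S` is a smooth distribution on `M`: locally it has a smooth frame. -/
def IsSmoothDistribution (S : Π p : M, Submodule ℝ (TangentSpace 𝓘(ℝ, E') p)) : Prop :=
  ∀ p₀ : M, ∃ 𝒱 : Set M, IsOpen 𝒱 ∧ p₀ ∈ 𝒱 ∧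
    ∃ (k : ℕ) (s : Fin k → Π p : M, TangentSpace 𝓘(ℝ, E') p),
      (∀ a, SmoothField 𝒱 (s a)) ∧
      ∀ p ∈ 𝒱, LinearIndependent ℝ (fun a ↦ s a p) ∧
        Submodule.span ℝ (Set.range fun a ↦ s a p) = S p

/-- `S` is a screen distribution `S(TM)`: a smooth distribution complementary to `TM^⊥` in `TM`. -/
structure IsScreen (g : PseudoRiemannianMetric E Mb) (i : M → Mb)
    (S : Π p : M, Submodule ℝ (TangentSpace 𝓘(ℝ, E') p)) : Prop where
  smooth : IsSmoothDistribution S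
  isCompl (p : M) : IsCompl (S p) (radical g i p)

/-- `{ξ, N}` is a normalizing pair on `𝒰` for the screen distribution `S`: `ξ` is a smooth section
of `TM^⊥`, and `N` a smooth section of `T Mb` along `M` with `ḡ (N, ξ) = 1`,
`ḡ (N, N) = 0` and `ḡ (N, W) = 0` for all `W` in `S`. -/
structure IsNormalizingPair (g : PseudoRiemannianMetric E Mb) (i : M → Mb)
    (S : Π p : M, Submodule ℝ (TangentSpace 𝓘(ℝ, E') p)) (𝒰 : Set M)
    (ξ : Π p : M, TangentSpace 𝓘(ℝ, E') p) (N : Π p : M, TangentSpace 𝓘(ℝ, E) (i p)) :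
    Prop where
  smooth_ξ : SmoothField 𝒰 ξ
  smooth_N : SmoothFieldAlong (E' := E') i 𝒰 N
  ξ_mem : ∀ p ∈ 𝒰, ξ p ∈ radical g i p
  N_ξ : ∀ p ∈ 𝒰, g.inner (i p) (N p) (di i p (ξ p)) = 1
  N_N : ∀ p ∈ 𝒰, g.inner (i p) (N p) (N p) = 0
  N_screen : ∀ p ∈ 𝒰, ∀ W ∈ S p, g.inner (i p) (N p) (di i p W) = 0

/-- The fibre of the lightlike transversal bundle `tr(TM)`. -/
def tr (i : M → Mb) (N : Π p : M, TangentSpace 𝓘(ℝ, E) (i p)) (p : M) :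
    Submodule ℝ (TangentSpace 𝓘(ℝ, E) (i p)) :=
  Submodule.span ℝ {N p}

/-- The projection of `T_{i p} Mb = T_p M ⊕ tr(TM)_p` onto `T_p M`. -/
def tangentPart (i : M → Mb) (N : Π p : M, TangentSpace 𝓘(ℝ, E) (i p)) (p : M)
    (w : TangentSpace 𝓘(ℝ, E) (i p)) : TangentSpace 𝓘(ℝ, E') p :=
  open scoped Classical in
  if h : Function.Injective (di (E := E) (E' := E') i p) ∧
      IsCompl (LinearMap.range (di (E := E) (E' := E') i p)) (tr i N p) then
    LinearMap.linearProjOfIsCompl (tr i N p) (di i p) h.1 h.2 w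
  else 0

section InducedObjects

variable (g : PseudoRiemannianMetric E Mb)
  (cov : CovariantDerivative 𝓘(ℝ, E) E (TangentSpace 𝓘(ℝ, E) : Mb → Type _))
  (i : M → Mb) (S : Π p : M, Submodule ℝ (TangentSpace 𝓘(ℝ, E') p))
  (ξ : Π p : M, TangentSpace 𝓘(ℝ, E') p) (N : Π p : M, TangentSpace 𝓘(ℝ, E) (i p))

/-- `∇̄_X Y` for vector fields `X`, `Y` on `M`. -/
def ambientCov (X Y : Π p : M, TangentSpace 𝓘(ℝ, E') p) (p : M) : TangentSpace 𝓘(ℝ, E) (i p) :=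
  covAlong cov i (fun q ↦ di i q (Y q)) p (X p)

/-- The induced connection `∇_X Y` on `M`, the tangential part of `∇̄_X Y`. -/
def inducedCov (X Y : Π p : M, TangentSpace 𝓘(ℝ, E') p) (p : M) : TangentSpace 𝓘(ℝ, E') p :=
  tangentPart i N p (ambientCov cov i X Y p)

/-- The local second fundamental form `B (X, Y) = ḡ (h (X, Y), ξ)`, where
`h (X, Y) = ∇̄_X Y - ∇_X Y`. -/
def B (X Y : Π p : M, TangentSpace 𝓘(ℝ, E') p) (p : M) : ℝ :=
  g.inner (i p) (ambientCov cov i X Y p - di i p (inducedCov cov i N X Y p)) (di i p (ξ p))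

/-- The shape operator `A_N X = -(tangential part of ∇̄_X N)`. -/
def shapeN (X : Π p : M, TangentSpace 𝓘(ℝ, E') p) (p : M) : TangentSpace 𝓘(ℝ, E') p :=
  -tangentPart i N p (covAlong cov i N p (X p))

/-- The projection `P` of `TM` onto `S(TM)` along `TM^⊥`. -/
def screenProj (p : M) : TangentSpace 𝓘(ℝ, E') p →ₗ[ℝ] TangentSpace 𝓘(ℝ, E') p :=
  projAlong (S p) (radical g i p)

/-- The shape operator of the screen distribution: `A*_ξ X = -P (∇_X ξ)`. -/
def shapeScreen (X : Π p : M, TangentSpace 𝓘(ℝ, E') p) (p : M) : TangentSpace 𝓘(ℝ, E') p :=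
  -screenProj g i S p (inducedCov cov i N X ξ p)

/-- The one-form `φ`, given by `∇_X ξ = -A*_ξ X + φ(X) ξ`, that is `φ(X) = ḡ (∇*ᵗ_X ξ, N)` with
`∇*ᵗ_X ξ = ∇_X ξ - P (∇_X ξ)` the `TM^⊥`-part of `∇_X ξ`. -/
def φ (X : Π p : M, TangentSpace 𝓘(ℝ, E') p) (p : M) : ℝ :=
  g.inner (i p)
    (di i p (inducedCov cov i N X ξ p - screenProj g i S p (inducedCov cov i N X ξ p))) (N p)

/-- The one-form `η = ḡ (N, ·)` on `M`. -/
def η (p : M) (u : TangentSpace 𝓘(ℝ, E') p) : ℝ :=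
  g.inner (i p) (N p) (di i p u)

/-- The map `♭ : X ↦ g₀ (X, ·) + η(X) η`. -/
def flat (p : M) (u : TangentSpace 𝓘(ℝ, E') p) : TangentSpace 𝓘(ℝ, E') p →ₗ[ℝ] ℝ where
  toFun v := inducedMetric g i p u v + η g i N p u * η g i N p v
  map_add' v w := by simp only [inducedMetric, η, map_add]; ring
  map_smul' c v := by
    simp only [inducedMetric, η, map_smul, smul_eq_mul, RingHom.id_apply]; ring

/-- The map `♯`, inverse of `♭`. -/
def sharp (p : M) (α : TangentSpace 𝓘(ℝ, E') p →ₗ[ℝ] ℝ) : TangentSpace 𝓘(ℝ, E') p :=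
  Function.invFun (flat (E' := E') g i N p) α

/-- `M` is totally geodesic: `∇̄_X Y` is tangent to `M` for all (local) vector fields `X`, `Y` on
`M`, i.e. the second fundamental form vanishes identically. -/
def IsTotallyGeodesic : Prop :=
  ∀ (𝒱 : Set M) (X Y : Π p : M, TangentSpace 𝓘(ℝ, E') p), IsOpen 𝒱 →
    SmoothField 𝒱 X → SmoothField 𝒱 Y →
    ∀ p ∈ 𝒱, ambientCov cov i X Y p ∈ LinearMap.range (di (E := E) (E' := E') i p)

end InducedObjects

/-! ## The almost contact structure `(F, θ₀, U)` -/

section AlmostContact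

variable (g : PseudoRiemannianMetric E Mb) (J : AlmostComplexStructure E Mb)
  (cov : CovariantDerivative 𝓘(ℝ, E) E (TangentSpace 𝓘(ℝ, E) : Mb → Type _))
  (i : M → Mb) (S : Π p : M, Submodule ℝ (TangentSpace 𝓘(ℝ, E') p))
  (ξ : Π p : M, TangentSpace 𝓘(ℝ, E') p) (N : Π p : M, TangentSpace 𝓘(ℝ, E) (i p))

/-- The vector of `T_p M` corresponding to a vector `w` tangent to `M` at `p`. -/
def toTangent (p : M) (w : TangentSpace 𝓘(ℝ, E) (i p)) : TangentSpace 𝓘(ℝ, E') p :=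
  Function.invFun (di (E := E) (E' := E') i p) w

/-- The distribution `J(TM^⊥)`, as a subspace of `TM`. -/
def JRadical (p : M) : Submodule ℝ (TangentSpace 𝓘(ℝ, E') p) :=
  ((normalSpace (E' := E') g i p).map (J.toFun (i p)).toLinearMap).comap (di i p)

/-- The distribution `J(tr(TM))`, as a subspace of `TM`. -/
def JTr (p : M) : Submodule ℝ (TangentSpace 𝓘(ℝ, E') p) :=
  ((tr i N p).map (J.toFun (i p)).toLinearMap).comap (di i p)

/-- `J(TM^⊥) ⊕ J(tr(TM))` is contained in the screen distribution `S(TM)` on `𝒰`. -/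
def IsAdaptedScreen (𝒰 : Set M) : Prop :=
  ∀ p ∈ 𝒰, (normalSpace (E' := E') g i p ⊔ tr i N p).map (J.toFun (i p)).toLinearMap ≤
    (S p).map (di i p)

/-- The distribution `D₀`: the `g₀`-orthogonal complement of `J(TM^⊥) ⊕ J(tr(TM))` in `S(TM)`. -/
def D₀ (p : M) : Submodule ℝ (TangentSpace 𝓘(ℝ, E') p) where
  carrier := {v | v ∈ S p ∧ ∀ w ∈ JRadical g J i p ⊔ JTr J i N p, inducedMetric g i p v w = 0}
  add_mem' {a b} ha hb := ⟨add_mem ha.1 hb.1, fun w hw ↦ by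
    have h1 := ha.2 w hw
    have h2 := hb.2 w hw
    simp only [inducedMetric] at h1 h2 ⊢
    rw [map_add, map_add, add_apply, h1, h2, add_zero]⟩
  zero_mem' := ⟨zero_mem _, fun w _ ↦ by
    simp only [inducedMetric, map_zero, zero_apply]⟩
  smul_mem' c a ha := ⟨Submodule.smul_mem _ c ha.1, fun w hw ↦ by
    have h1 := ha.2 w hw
    simp only [inducedMetric] at h1 ⊢
    rw [map_smul, map_smul, smul_apply, h1, smul_zero]⟩

/-- The distribution `Δ = (J(TM^⊥) ⊕ TM^⊥) ⊕ D₀`. -/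
def Delta (p : M) : Submodule ℝ (TangentSpace 𝓘(ℝ, E') p) :=
  JRadical g J i p ⊔ radical g i p ⊔ D₀ g J i S N p

/-- The projection `σ` of `TM = Δ ⊕ J(tr(TM))` onto `Δ`. -/
def σ (p : M) : TangentSpace 𝓘(ℝ, E') p →ₗ[ℝ] TangentSpace 𝓘(ℝ, E') p :=
  projAlong (Delta g J i S N p) (JTr J i N p)

/-- The vector field `U = -J N` on `M`. -/
def U (p : M) : TangentSpace 𝓘(ℝ, E') p :=
  toTangent i p (-J.toFun (i p) (N p))

/-- The vector field `V = -J ξ` on `M`. -/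
def V (p : M) : TangentSpace 𝓘(ℝ, E') p :=
  toTangent i p (-J.toFun (i p) (di i p (ξ p)))

/-- The one-form `θ₀ = g₀ (·, V)` on `M`. -/
def θ₀ (p : M) : TangentSpace 𝓘(ℝ, E') p →ₗ[ℝ] ℝ where
  toFun u := inducedMetric g i p u (V J i ξ p)
  map_add' u v := by
    simp only [inducedMetric, map_add, add_apply]
  map_smul' c u := by
    simp only [inducedMetric, map_smul, smul_apply, RingHom.id_apply]

/-- The endomorphism field `F = J ∘ σ` on `M`. -/
def F (p : M) (u : TangentSpace 𝓘(ℝ, E') p) : TangentSpace 𝓘(ℝ, E') p :=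
  toTangent i p (J.toFun (i p) (di i p (σ g J i S N p u)))

/-- The vector field `θ₀^♯`. -/
def θ₀Sharp (p : M) : TangentSpace 𝓘(ℝ, E') p :=
  sharp g i N p (θ₀ g J i ξ p)

/-- `(D_X θ₀)(Y) = X (θ₀ Y) - θ₀ (D_X Y)`, with `D` the induced connection. -/
def covθ₀ (X Y : Π p : M, TangentSpace 𝓘(ℝ, E') p) (p : M) : ℝ :=
  mvfderiv 𝓘(ℝ, E') (fun q ↦ θ₀ g J i ξ q (Y q)) p (X p) -
    θ₀ g J i ξ p (inducedCov cov i N X Y p)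

/-- `(D_X F)(Y) = D_X (F Y) - F (D_X Y)`, with `D` the induced connection. -/
def covF (X Y : Π p : M, TangentSpace 𝓘(ℝ, E') p) (p : M) : TangentSpace 𝓘(ℝ, E') p :=
  inducedCov cov i N X (fun q ↦ F g J i S N q (Y q)) p -
    F g J i S N p (inducedCov cov i N X Y p)

end AlmostContact

end Hypersurface

end

end LightlikeKahler

open LightlikeKahler

/-!
Everything is computed in the ambient tangent bundle along the immersion `i`, where three facts
suffice.

* The ambient connection pulled back to fields along `i` satisfies the product rule for the metric
  (`mvfderiv_inner`) and commutes with `J` (`covAlong_J`). Both sides of either identity obey the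
  Leibniz rule, and every differentiable field along `i` is locally a combination of frame fields of
  `T Mb` (`MDiffAlong.induction`), so it is enough to know them for vector fields on `Mb`.
* `T Mb = T M ⊕ tr(TM)`, the tangent space being the hyperplane orthogonal to `ξ`. Hence the
  transversal component of `w` is `g(w, ξ) N` (`di_tangentPart`), which gives the Gauss formula
  `di_inducedCov`. Differentiating `g(N, ξ) = 1`, `g(ξ, ξ) = 0` and `g(Y, ξ) = 0` gives the
  Weingarten formula `weingarten`, the tangency of `∇̄_X ξ`, and
  `B(X, Y) = -g(Y, ∇̄_X ξ)` (`inner_ambientCov_ξ`).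
* `J Y = F Y + θ₀(Y) N` (`di_F`), because `Δ` is the kernel of `θ₀` (`mem_Delta_iff`), `θ₀(U) = 1`
  and `J U = N`. Also `θ₀^♯ = V` (`θ₀Sharp_eq_V`).

The derivative of `θ₀` comes from the product rule for `θ₀(Y) = g(J Y, ξ)`; the derivative of `F` is
the tangential part of the derivative of `J Y = F Y + θ₀(Y) N`; and the formulas for `φ` and `θ₀^♯`
come from differentiating `U = -J N` and `V = -J ξ`. If `M` is totally geodesic, then
`g(Y, ∇̄_X ξ) = 0` for every tangent `Y`, so `B(X, F Y)` and `A*_ξ X` vanish.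
-/

namespace LightlikeKahler

open scoped Topology

/-! ### The covariant derivative along a map -/

section Along

variable {E : Type*} [NormedAddCommGroup E] [NormedSpace ℝ E]
  {Mb : Type*} [TopologicalSpace Mb] [ChartedSpace E Mb] [IsManifold 𝓘(ℝ, E) ∞ Mb]
  {E' : Type*} [NormedAddCommGroup E'] [NormedSpace ℝ E']
  {M : Type*} [TopologicalSpace M] [ChartedSpace E' M]

/-- The vector field `Y` along `i : M → Mb` is differentiable at `p`. -/
abbrev MDiffAlong (i : M → Mb) (Y : Π q : M, TangentSpace 𝓘(ℝ, E) (i q)) (p : M) : Prop :=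
  MDifferentiableAt 𝓘(ℝ, E') 𝓘(ℝ, E).tangent
    (fun q ↦ (⟨i q, Y q⟩ : TangentBundle 𝓘(ℝ, E) Mb)) p

/-- The vector field `W` on `Mb` is differentiable at `x`. -/
abbrev MDiffField (W : Π x : Mb, TangentSpace 𝓘(ℝ, E) x) (x : Mb) : Prop :=
  MDifferentiableAt 𝓘(ℝ, E) 𝓘(ℝ, E).tangent (fun y ↦ (⟨y, W y⟩ : TangentBundle 𝓘(ℝ, E) Mb)) x

/-- The components of the vector field `Y` along `i` in the trivialization of `T Mb` at `x`. -/
noncomputable abbrev coords (x : Mb) (i : M → Mb) (Y : Π q : M, TangentSpace 𝓘(ℝ, E) (i q))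
    (q : M) : E :=
  (trivializationAt E (TangentSpace 𝓘(ℝ, E) : Mb → Type _) x).continuousLinearMapAt ℝ (i q) (Y q)

variable {i : M → Mb} {Y Z : Π q : M, TangentSpace 𝓘(ℝ, E) (i q)} {p : M}

lemma eventually_mem_baseSet (hi : ContinuousAt i p) :
    ∀ᶠ q in 𝓝 p, i q ∈ (trivializationAt E (TangentSpace 𝓘(ℝ, E) : Mb → Type _) (i p)).baseSet :=
  hi.preimage_mem_nhds ((Trivialization.open_baseSet _).mem_nhds
    (FiberBundle.mem_baseSet_trivializationAt' (i p)))

lemma mdiffAlong_iff :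
    MDiffAlong (E' := E') i Y p ↔ MDifferentiableAt 𝓘(ℝ, E') 𝓘(ℝ, E) i p ∧
      MDifferentiableAt 𝓘(ℝ, E') 𝓘(ℝ, E) (coords (i p) i Y) p := by
  rw [MDiffAlong, ModelWithCorners.tangent,
    mdifferentiableAt_totalSpace (E := (TangentSpace 𝓘(ℝ, E) : Mb → Type _)) (IB := 𝓘(ℝ, E))]
  refine and_congr_right fun hi ↦ Filter.EventuallyEq.mdifferentiableAt_iff ?_
  filter_upwards [eventually_mem_baseSet (E := E) hi.continuousAt] with q hq
  rw [coords, Trivialization.continuousLinearMapAt_apply,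
    Trivialization.coe_linearMapAt_of_mem _ hq]

lemma MDiffAlong.base (hY : MDiffAlong (E' := E') i Y p) :
    MDifferentiableAt 𝓘(ℝ, E') 𝓘(ℝ, E) i p :=
  (mdiffAlong_iff.1 hY).1

lemma MDiffAlong.add (hY : MDiffAlong (E' := E') i Y p) (hZ : MDiffAlong (E' := E') i Z p) :
    MDiffAlong (E' := E') i (fun q ↦ Y q + Z q) p := by
  rw [mdiffAlong_iff] at *
  refine ⟨hY.1, (hY.2.add hZ.2).congr_of_eventuallyEq (.of_forall fun q ↦ ?_)⟩
  simp [coords]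

lemma MDiffAlong.smul {f : M → ℝ} (hf : MDifferentiableAt 𝓘(ℝ, E') 𝓘(ℝ, ℝ) f p)
    (hY : MDiffAlong (E' := E') i Y p) :
    MDiffAlong (E' := E') i (fun q ↦ f q • Y q) p := by
  rw [mdiffAlong_iff] at *
  refine ⟨hY.1, (hf.smul hY.2).congr_of_eventuallyEq (.of_forall fun q ↦ ?_)⟩
  simp [coords]

lemma MDiffAlong.congr (hY : MDiffAlong (E' := E') i Y p) (h : ∀ᶠ q in 𝓝 p, Z q = Y q) :
    MDiffAlong (E' := E') i Z p :=
  MDifferentiableAt.congr_of_eventuallyEq hY (h.mono fun q hq ↦ by simp [hq])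

lemma MDiffAlong.comp {W : Π x : Mb, TangentSpace 𝓘(ℝ, E) x}
    (hi : MDifferentiableAt 𝓘(ℝ, E') 𝓘(ℝ, E) i p) (hW : MDiffField W (i p)) :
    MDiffAlong (E' := E') i (fun q ↦ W (i q)) p :=
  MDifferentiableAt.comp p hW hi

lemma mdiffField_extend (x : Mb) (c : TangentSpace 𝓘(ℝ, E) x) :
    MDiffField (FiberBundle.extend E c) x :=
  FiberBundle.mdifferentiableAt_extend 𝓘(ℝ, E) E c

/-- On the base set of the trivialization at `x`, the frame field `extend E c` has constant
components; outside it the value is arbitrary. -/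
lemma extend_eq_symmL {x y : Mb} (c : TangentSpace 𝓘(ℝ, E) x)
    (hy : y ∈ (trivializationAt E (TangentSpace 𝓘(ℝ, E) : Mb → Type _) x).baseSet) :
    FiberBundle.extend E c y =
      (trivializationAt E (TangentSpace 𝓘(ℝ, E) : Mb → Type _) x).symmL ℝ y
        ((trivializationAt E (TangentSpace 𝓘(ℝ, E) : Mb → Type _) x).continuousLinearMapAt ℝ x
          c) := by
  rw [Trivialization.continuousLinearMapAt_apply, Trivialization.coe_linearMapAt_of_mem _
    (FiberBundle.mem_baseSet_trivializationAt' x)]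
  exact (Trivialization.symmL_apply _ hy _).symm

/-- `extend E` is additive on a neighbourhood of `x` only, so the locality of `cov` is needed. -/
lemma cov_extend_add (cov : CovariantDerivative 𝓘(ℝ, E) E (TangentSpace 𝓘(ℝ, E) : Mb → Type _))
    {x : Mb} (c d : TangentSpace 𝓘(ℝ, E) x) :
    cov (FiberBundle.extend E (c + d)) x =
      cov (FiberBundle.extend E c) x + cov (FiberBundle.extend E d) x := by
  have hc := mdiffField_extend x c
  have hd := mdiffField_extend x d
  rw [← cov.isCovariantDerivativeOnUniv.add hc hd]
  refine cov.isCovariantDerivativeOnUniv.congr_of_eventuallyEq (mdiffField_extend _ _)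
    (mdifferentiableAt_add_section hc hd) Filter.univ_mem ?_
  filter_upwards [eventually_mem_baseSet (E := E) (i := fun x : Mb ↦ x) continuousAt_id] with y hy
  simp [extend_eq_symmL _ hy]

lemma cov_extend_smul (cov : CovariantDerivative 𝓘(ℝ, E) E (TangentSpace 𝓘(ℝ, E) : Mb → Type _))
    {x : Mb} (r : ℝ) (c : TangentSpace 𝓘(ℝ, E) x) :
    cov (FiberBundle.extend E (r • c)) x = r • cov (FiberBundle.extend E c) x := by
  have hc := mdiffField_extend x c
  rw [← cov.isCovariantDerivativeOnUniv.smul_const r hc]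
  refine cov.isCovariantDerivativeOnUniv.congr_of_eventuallyEq (mdiffField_extend _ _)
    (hc.smul_const_section (a := r)) Filter.univ_mem ?_
  filter_upwards [eventually_mem_baseSet (E := E) (i := fun x : Mb ↦ x) continuousAt_id] with y hy
  simp [extend_eq_symmL _ hy]

/-- A differentiable vector field along `i` is locally a combination of frame fields of `T Mb` with
differentiable coefficients, so it suffices to treat frame fields, sums and multiples. -/
theorem MDiffAlong.induction [FiniteDimensional ℝ E]
    (P : (Π q : M, TangentSpace 𝓘(ℝ, E) (i q)) → Prop)
    (hY : MDiffAlong (E' := E') i Y p)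
    (extend : ∀ c : TangentSpace 𝓘(ℝ, E) (i p), P (fun q ↦ FiberBundle.extend E c (i q)))
    (add : ∀ Y Z, MDiffAlong (E' := E') i Y p → MDiffAlong (E' := E') i Z p → P Y → P Z →
      P (fun q ↦ Y q + Z q))
    (smul : ∀ (f : M → ℝ) Y, MDifferentiableAt 𝓘(ℝ, E') 𝓘(ℝ, ℝ) f p →
      MDiffAlong (E' := E') i Y p → P Y → P (fun q ↦ f q • Y q))
    (congr : ∀ Y Z, MDiffAlong (E' := E') i Y p → (∀ᶠ q in 𝓝 p, Z q = Y q) → P Y → P Z) :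
    P Y := by
  classical
  obtain ⟨hi, hc⟩ := mdiffAlong_iff.1 hY
  set e := trivializationAt E (TangentSpace 𝓘(ℝ, E) : Mb → Type _) (i p) with he
  let b := Module.finBasis ℝ E
  let c (a) : TangentSpace 𝓘(ℝ, E) (i p) := e.symm (i p) (b a)
  let y (a) (q : M) : ℝ := (b.coord a).toContinuousLinearMap (coords (i p) i Y q)
  have hy (a) : MDifferentiableAt 𝓘(ℝ, E') 𝓘(ℝ, ℝ) (y a) p :=
    ((b.coord a).toContinuousLinearMap.differentiableAt.mdifferentiableAt).comp p hc
  have hE (a) : MDiffAlong (E' := E') i (fun q ↦ FiberBundle.extend E (c a) (i q)) p :=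
    .comp hi (mdiffField_extend _ _)
  have key (s : Finset (Fin (Module.finrank ℝ E))) :
      MDiffAlong (E' := E') i (fun q ↦ ∑ a ∈ s, y a q • FiberBundle.extend E (c a) (i q)) p ∧
      P (fun q ↦ ∑ a ∈ s, y a q • FiberBundle.extend E (c a) (i q)) := by
    induction s using Finset.induction_on with
    | empty =>
      have h0 : MDifferentiableAt 𝓘(ℝ, E') 𝓘(ℝ, ℝ) (fun _ : M ↦ (0 : ℝ)) p :=
        mdifferentiableAt_const
      have hd : MDiffAlong (E' := E') i (fun q ↦ FiberBundle.extend E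
          (0 : TangentSpace 𝓘(ℝ, E) (i p)) (i q)) p := .comp hi (mdiffField_extend _ _)
      simpa using And.intro (hd.smul h0) (smul _ _ h0 hd (extend 0))
    | insert a s ha ih =>
      simp only [Finset.sum_insert ha]
      exact ⟨((hE a).smul (hy a)).add ih.1,
        add _ _ ((hE a).smul (hy a)) ih.1 (smul _ _ (hy a) (hE a) (extend _)) ih.2⟩
  refine congr _ _ (key Finset.univ).1 ?_ (key Finset.univ).2
  filter_upwards [eventually_mem_baseSet (E := E) hi.continuousAt] with q hq
  have hp : i p ∈ e.baseSet := FiberBundle.mem_baseSet_trivializationAt' (i p)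
  have h1 (a) : FiberBundle.extend E (c a) (i q) = e.symmL ℝ (i q) (b a) := by
    simp only [FiberBundle.extend, ← he, c, e.apply_mk_symm hp]
    exact (e.symmL_apply hq _).symm
  simp only [h1, ← map_smul, ← map_sum]
  have h2 : ∑ a, y a q • b a = coords (i p) i Y q := b.sum_repr _
  rw [h2]
  exact (e.symmL_continuousLinearMapAt hq _).symm

section Cov

variable (cov : CovariantDerivative 𝓘(ℝ, E) E (TangentSpace 𝓘(ℝ, E) : Mb → Type _))
  (v : TangentSpace 𝓘(ℝ, E') p)

lemma mvfderiv_congr {F : Type*} [NormedAddCommGroup F] [NormedSpace ℝ F] {f h : M → F}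
    (hfh : ∀ᶠ q in 𝓝 p, f q = h q) : mvfderiv 𝓘(ℝ, E') f p v = mvfderiv 𝓘(ℝ, E') h p v := by
  have h1 : mfderiv 𝓘(ℝ, E') 𝓘(ℝ, F) f p = mfderiv 𝓘(ℝ, E') 𝓘(ℝ, F) h p :=
    Filter.EventuallyEq.mfderiv_eq hfh
  have h2 : f p = h p := hfh.self_of_nhds
  simp only [mvfderiv]
  rw [h1]
  rfl

lemma covAlong_def :
    covAlong cov i Y p v =
      (trivializationAt E (TangentSpace 𝓘(ℝ, E) : Mb → Type _) (i p)).symmL ℝ (i p)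
        (mvfderiv 𝓘(ℝ, E') (coords (i p) i Y) p v) +
      cov (FiberBundle.extend E (Y p)) (i p) (di i p v) := rfl

variable (Y Z) in
lemma covAlong_congr (h : ∀ᶠ q in 𝓝 p, Y q = Z q) :
    covAlong cov i Y p v = covAlong cov i Z p v := by
  have h1 : Y p = Z p := h.self_of_nhds
  have h2 := mvfderiv_congr (E' := E') v (f := coords (i p) i Y) (h := coords (i p) i Z)
    (h.mono fun q hq ↦ by simp [coords, hq])
  rw [covAlong_def, covAlong_def, h2, h1]

lemma covAlong_add (hY : MDiffAlong (E' := E') i Y p) (hZ : MDiffAlong (E' := E') i Z p) :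
    covAlong cov i (fun q ↦ Y q + Z q) p v = covAlong cov i Y p v + covAlong cov i Z p v := by
  rw [mdiffAlong_iff] at hY hZ
  have h : coords (i p) i (fun q ↦ Y q + Z q) = coords (i p) i Y + coords (i p) i Z := by
    ext q; simp [coords]
  rw [covAlong_def, covAlong_def, covAlong_def, h, mvfderiv_add hY.2 hZ.2,
    cov_extend_add]
  simp only [add_apply, map_add]
  abel

lemma covAlong_smul {f : M → ℝ} (hf : MDifferentiableAt 𝓘(ℝ, E') 𝓘(ℝ, ℝ) f p)
    (hY : MDiffAlong (E' := E') i Y p) :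
    covAlong cov i (fun q ↦ f q • Y q) p v =
      f p • covAlong cov i Y p v + mvfderiv 𝓘(ℝ, E') f p v • Y p := by
  rw [mdiffAlong_iff] at hY
  have h : coords (i p) i (fun q ↦ f q • Y q) = f • coords (i p) i Y := by
    ext q; simp [coords]
  have h' : (trivializationAt E (TangentSpace 𝓘(ℝ, E) : Mb → Type _) (i p)).symmL ℝ (i p)
      (coords (i p) i Y p) = Y p := Trivialization.symmL_continuousLinearMapAt _
        (FiberBundle.mem_baseSet_trivializationAt' (i p)) _
  rw [covAlong_def, covAlong_def, h, mvfderiv_smul hf hY.2,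
    cov_extend_smul]
  simp only [add_apply, smul_apply, ContinuousLinearMap.smulRight_apply, map_add, map_smul, h',
    smul_add]
  abel

lemma covAlong_neg (hY : MDiffAlong (E' := E') i Y p) :
    covAlong cov i (fun q ↦ -Y q) p v = -covAlong cov i Y p v := by
  have h := covAlong_smul (f := fun _ ↦ (-1 : ℝ)) cov v mdifferentiableAt_const hY
  simpa [mvfderiv_const] using h

/-- Along `i`, a frame field of `T Mb` has constant components, so only the connection term of
`covAlong` survives. -/
lemma covAlong_extend (hi : ContinuousAt i p) (c : TangentSpace 𝓘(ℝ, E) (i p)) :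
    covAlong cov i (fun q ↦ FiberBundle.extend E c (i q)) p v =
      cov (FiberBundle.extend E c) (i p) (di i p v) := by
  have h := mvfderiv_congr (E' := E') v
    (f := coords (i p) i (fun q ↦ FiberBundle.extend E c (i q)))
    (h := fun _ ↦ (trivializationAt E (TangentSpace 𝓘(ℝ, E) : Mb → Type _)
      (i p)).continuousLinearMapAt ℝ (i p) c) (by
        filter_upwards [eventually_mem_baseSet (E := E) hi] with q hq
        simp only [coords, extend_eq_symmL _ hq]
        exact Trivialization.continuousLinearMapAt_symmL _ hq _)
  rw [covAlong_def, h, mvfderiv_const, FiberBundle.extend_apply_self]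
  simp

/-- Chain rule: the covariant derivative of `W ∘ i`, for a vector field `W` on `Mb`. -/
theorem covAlong_comp [FiniteDimensional ℝ E] {W : Π x : Mb, TangentSpace 𝓘(ℝ, E) x}
    (hi : MDifferentiableAt 𝓘(ℝ, E') 𝓘(ℝ, E) i p) (hW : MDiffField W (i p)) :
    covAlong cov i (fun q ↦ W (i q)) p v = cov W (i p) (di i p v) := by
  refine MDiffAlong.induction (i := fun x : Mb ↦ x) (p := i p) (E' := E) (Y := W)
    (fun W ↦ covAlong cov i (fun q ↦ W (i q)) p v = cov W (i p) (di i p v)) hW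
    (fun c ↦ covAlong_extend cov v hi.continuousAt c) ?_ ?_ ?_
  · intro Y Z hY hZ h1 h2
    rw [covAlong_add cov v (.comp hi hY) (.comp hi hZ), h1, h2]
    exact congr($((cov.isCovariantDerivativeOnUniv.add hY hZ).symm) (di i p v))
  · intro f Y hf hY h1
    rw [covAlong_smul (f := fun q ↦ f (i q)) cov v (hf.comp p hi) (.comp hi hY), h1]
    have h2 := congr($(cov.isCovariantDerivativeOnUniv.leibniz hY hf) (di i p v))
    refine Eq.trans ?_ h2.symm
    have h3 : mvfderiv 𝓘(ℝ, E') (fun q ↦ f (i q)) p v = mvfderiv 𝓘(ℝ, E) f (i p) (di i p v) :=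
      mvfderiv_comp_apply p hf hi v
    rw [h3]
    rfl
  · intro Y Z hY h h1
    rw [covAlong_congr _ _ cov v (hi.continuousAt.eventually h), h1,
      cov.isCovariantDerivativeOnUniv.congr_of_eventuallyEq hY (MDiffAlong.congr hY h)
        Filter.univ_mem (h.mono fun _ h ↦ h.symm)]

variable {g : PseudoRiemannianMetric E Mb} {J : AlmostComplexStructure E Mb} {cov}

lemma MDiffAlong.complexStructure (J : AlmostComplexStructure E Mb)
    (hY : MDiffAlong (E' := E') i Y p) :
    MDiffAlong (E' := E') i (fun q ↦ J.toFun (i q) (Y q)) p :=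
  MDifferentiableAt.clm_bundle_apply
    (((J.contMDiff (i p)).mdifferentiableAt (by simp)).comp p hY.base) hY

lemma MDiffAlong.inner (g : PseudoRiemannianMetric E Mb) (hY : MDiffAlong (E' := E') i Y p)
    (hZ : MDiffAlong (E' := E') i Z p) :
    MDifferentiableAt 𝓘(ℝ, E') 𝓘(ℝ, ℝ) (fun q ↦ g.inner (i q) (Y q) (Z q)) p := by
  have h := MDifferentiableAt.clm_bundle_apply₂ (F₁ := E) (F₂ := E) (F₃ := ℝ)
    (E₁ := (TangentSpace 𝓘(ℝ, E) : Mb → Type _)) (E₂ := (TangentSpace 𝓘(ℝ, E) : Mb → Type _))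
    (E₃ := Trivial Mb ℝ) (ψ := fun q ↦ g.inner (i q))
    (((g.contMDiff (i p)).mdifferentiableAt (by simp)).comp p hY.base) hY hZ
  rw [mdifferentiableAt_totalSpace] at h
  exact h.2

/-- A parallel almost complex structure commutes with the covariant derivative along `i`. -/
theorem covAlong_J [FiniteDimensional ℝ E] (hJ : IsParallel cov J)
    (hY : MDiffAlong (E' := E') i Y p) :
    covAlong cov i (fun q ↦ J.toFun (i q) (Y q)) p v = J.toFun (i p) (covAlong cov i Y p v) := by
  have hi := hY.base
  refine hY.induction (fun Y ↦ covAlong cov i (fun q ↦ J.toFun (i q) (Y q)) p v =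
    J.toFun (i p) (covAlong cov i Y p v)) ?_ ?_ ?_ ?_
  · intro c
    have hc := mdiffField_extend (E := E) (i p) c
    rw [covAlong_extend cov v hi.continuousAt,
      covAlong_comp (W := fun x ↦ J.toFun x (FiberBundle.extend E c x)) cov v hi
        (MDiffAlong.complexStructure (E' := E) (i := fun x ↦ x) J hc), hJ _ _ _ hc]
  · intro Y Z hY hZ h1 h2
    simp only [map_add]
    rw [covAlong_add cov v hY hZ,
      covAlong_add cov v (hY.complexStructure J) (hZ.complexStructure J),
      h1, h2, map_add]
  · intro f Y hf hY h1
    simp only [map_smul]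
    rw [covAlong_smul cov v hf hY, covAlong_smul cov v hf (hY.complexStructure J), h1,
      map_add, map_smul, map_smul]
  · intro Y Z hY h h1
    rw [covAlong_congr _ _ cov v h, ← h1]
    exact covAlong_congr _ _ cov v (h.mono fun q hq ↦ by simp only [hq])

/-- The Levi-Civita connection along `i` satisfies the product rule for the metric. -/
theorem mvfderiv_inner [FiniteDimensional ℝ E] (hg : IsLeviCivita g cov)
    (hY : MDiffAlong (E' := E') i Y p) (hZ : MDiffAlong (E' := E') i Z p) :
    mvfderiv 𝓘(ℝ, E') (fun q ↦ g.inner (i q) (Y q) (Z q)) p v =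
      g.inner (i p) (covAlong cov i Y p v) (Z p) +
        g.inner (i p) (Y p) (covAlong cov i Z p v) := by
  have hi := hY.base
  refine hY.induction (fun Y ↦ mvfderiv 𝓘(ℝ, E') (fun q ↦ g.inner (i q) (Y q) (Z q)) p v =
      g.inner (i p) (covAlong cov i Y p v) (Z p) +
        g.inner (i p) (Y p) (covAlong cov i Z p v)) ?_ ?_ ?_ ?_
  · intro c
    have hc := mdiffField_extend (E := E) (i p) c
    have hc' := MDiffAlong.comp hi hc
    refine hZ.induction (fun Z ↦ mvfderiv 𝓘(ℝ, E')
        (fun q ↦ g.inner (i q) (FiberBundle.extend E c (i q)) (Z q)) p v =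
      g.inner (i p) (covAlong cov i (fun q ↦ FiberBundle.extend E c (i q)) p v) (Z p) +
        g.inner (i p) (FiberBundle.extend E c (i p)) (covAlong cov i Z p v)) ?_ ?_ ?_ ?_
    · intro d
      have hd := mdiffField_extend (E := E) (i p) d
      rw [covAlong_extend cov v hi.continuousAt, covAlong_extend cov v hi.continuousAt,
        ← hg.2 _ _ _ _ hc hd]
      exact mvfderiv_comp_apply p (MDiffAlong.inner (i := fun x ↦ x) g hc hd) hi v
    · intro Y Z hY hZ h1 h2
      simp only [map_add]
      rw [covAlong_add cov v hY hZ, mvfderiv_fun_add (hc'.inner g hY) (hc'.inner g hZ), add_apply,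
        h1, h2, map_add]
      ring
    · intro f Y hf hY h1
      simp only [map_smul, smul_eq_mul]
      rw [covAlong_smul cov v hf hY, mvfderiv_fun_mul hf (hc'.inner g hY), add_apply,
        smul_apply, smul_apply, h1, map_add, map_smul, map_smul]
      simp only [smul_eq_mul]
      ring
    · intro Y Z hY h h1
      rw [covAlong_congr _ _ cov v h, h.self_of_nhds, ← h1]
      exact mvfderiv_congr v (h.mono fun q hq ↦ by simp only [hq])
  · intro Y₁ Y₂ h₁ h₂ h1 h2
    simp only [map_add, add_apply]
    rw [covAlong_add cov v h₁ h₂, mvfderiv_fun_add (h₁.inner g hZ) (h₂.inner g hZ), add_apply,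
      h1, h2, map_add, add_apply]
    ring
  · intro f Y hf hY h1
    simp only [map_smul, smul_apply, smul_eq_mul]
    rw [covAlong_smul cov v hf hY, mvfderiv_fun_mul hf (hY.inner g hZ), add_apply,
      smul_apply, smul_apply, h1, map_add, map_smul, map_smul]
    simp only [smul_eq_mul, add_apply, smul_apply]
    ring
  · intro Y Y' hY h h1
    rw [covAlong_congr _ _ cov v h, h.self_of_nhds, ← h1]
    exact mvfderiv_congr v (h.mono fun q hq ↦ by simp only [hq])

end Cov

end Along

/-! ### Projections and screen fields -/

section Pointwise

lemma projAlong_eq {V : Type*} [AddCommGroup V] [Module ℝ V] {A C : Submodule ℝ V}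
    (h : IsCompl A C) {v a c : V} (ha : a ∈ A) (hc : c ∈ C) (hv : v = a + c) :
    projAlong A C v = a := by
  rw [projAlong, dif_pos h, hv, map_add, Submodule.projection_apply_of_mem_left _ ha,
    Submodule.projection_apply_of_mem_right _ hc, add_zero]

variable {E : Type*} [NormedAddCommGroup E] [NormedSpace ℝ E]
  {Mb : Type*} [TopologicalSpace Mb] [ChartedSpace E Mb]
  {E' : Type*} [NormedAddCommGroup E'] [NormedSpace ℝ E']
  {M : Type*} [TopologicalSpace M] [ChartedSpace E' M] {i : M → Mb} {p : M}

lemma di_toTangent {w : TangentSpace 𝓘(ℝ, E) (i p)}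
    (hw : w ∈ LinearMap.range (di (E := E) (E' := E') i p)) :
    di (E' := E') i p (toTangent i p w) = w :=
  Function.invFun_eq hw

variable [IsManifold 𝓘(ℝ, E) ∞ Mb]
  {g : PseudoRiemannianMetric E Mb} {J : AlmostComplexStructure E Mb}
  {cov : CovariantDerivative 𝓘(ℝ, E) E (TangentSpace 𝓘(ℝ, E) : Mb → Type _)}
  {S : Π p : M, Submodule ℝ (TangentSpace 𝓘(ℝ, E') p)} {𝒰 : Set M}
  {ξ : Π p : M, TangentSpace 𝓘(ℝ, E') p} {N : Π p : M, TangentSpace 𝓘(ℝ, E) (i p)}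

lemma IsHermitian.inner_J_left (hg : IsHermitian g J) {x : Mb} (v w : TangentSpace 𝓘(ℝ, E) x) :
    g.inner x (J.toFun x v) w = -g.inner x v (J.toFun x w) := by
  have h := hg x v (J.toFun x w)
  rw [J.sq, map_neg] at h
  linarith

lemma IsAdaptedScreen.exists_screen (hJS : IsAdaptedScreen g J i S N 𝒰) (hp : p ∈ 𝒰)
    {w : TangentSpace 𝓘(ℝ, E) (i p)} (hw : w ∈ normalSpace (E' := E') g i p ⊔ tr i N p) :
    ∃ s ∈ S p, di i p s = -J.toFun (i p) w := by
  obtain ⟨s, hs, h⟩ := hJS p hp (Submodule.mem_map_of_mem hw)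
  exact ⟨-s, neg_mem hs, by rw [map_neg, h]; rfl⟩

lemma U_spec (hi : IsLightlike (E' := E') g i) (hJS : IsAdaptedScreen g J i S N 𝒰) (hp : p ∈ 𝒰) :
    U (E' := E') J i N p ∈ S p ∧ di (E' := E') i p (U J i N p) = -J.toFun (i p) (N p) := by
  obtain ⟨s, hs, h⟩ := hJS.exists_screen hp
    (Submodule.mem_sup_right (Submodule.mem_span_singleton_self (N p)))
  have h1 : di (E' := E') i p (U J i N p) = -J.toFun (i p) (N p) := di_toTangent ⟨s, h⟩
  exact ⟨hi.injective p (h.trans h1.symm) ▸ hs, h1⟩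

lemma mem_JTr_iff (hi : IsLightlike (E' := E') g i)
    (hJS : IsAdaptedScreen g J i S N 𝒰) (hp : p ∈ 𝒰) (u : TangentSpace 𝓘(ℝ, E') p) :
    u ∈ JTr J i N p ↔ ∃ c : ℝ, u = c • U J i N p := by
  constructor
  · rintro ⟨w, hw, h⟩
    obtain ⟨c, rfl⟩ := Submodule.mem_span_singleton.1 hw
    refine ⟨-c, hi.injective p ?_⟩
    rw [← h]
    simp [(U_spec hi hJS hp).2]
  · rintro ⟨c, rfl⟩
    refine ⟨-c • N p, Submodule.smul_mem _ _ (Submodule.mem_span_singleton_self _), ?_⟩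
    simp [(U_spec hi hJS hp).2]

variable [IsManifold 𝓘(ℝ, E') ∞ M]

/-! ### The splitting of `T Mb` into `T M` and the transversal bundle -/

section Transversal

lemma IsNormalizingPair.ξ_inner_di (hξN : IsNormalizingPair g i S 𝒰 ξ N) (hp : p ∈ 𝒰)
    (u : TangentSpace 𝓘(ℝ, E') p) : g.inner (i p) (di i p (ξ p)) (di i p u) = 0 :=
  hξN.ξ_mem p hp u

lemma IsNormalizingPair.di_inner_ξ (hξN : IsNormalizingPair g i S 𝒰 ξ N) (hp : p ∈ 𝒰)
    (u : TangentSpace 𝓘(ℝ, E') p) : g.inner (i p) (di i p u) (di i p (ξ p)) = 0 := by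
  rw [g.symm, hξN.ξ_inner_di hp]

lemma B_eq (hξN : IsNormalizingPair g i S 𝒰 ξ N) (hp : p ∈ 𝒰)
    (X Y : Π p : M, TangentSpace 𝓘(ℝ, E') p) :
    B g cov i ξ N X Y p = g.inner (i p) (ambientCov cov i X Y p) (di i p (ξ p)) := by
  rw [B, map_sub, sub_apply, hξN.di_inner_ξ hp, sub_zero]

variable [FiniteDimensional ℝ E]

/-- A vector of `T Mb` is tangent to the hypersurface exactly when it is orthogonal to `ξ`: both
subspaces are hyperplanes. -/
lemma mem_range_di_iff (hdim : Module.finrank ℝ E' + 1 = Module.finrank ℝ E)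
    (hi : IsLightlike (E' := E') g i) (hξN : IsNormalizingPair g i S 𝒰 ξ N) (hp : p ∈ 𝒰)
    (w : TangentSpace 𝓘(ℝ, E) (i p)) :
    w ∈ LinearMap.range (di (E := E) (E' := E') i p) ↔
      g.inner (i p) w (di i p (ξ p)) = 0 := by
  let f : TangentSpace 𝓘(ℝ, E) (i p) →ₗ[ℝ] ℝ := (g.inner (i p) (di i p (ξ p))).toLinearMap
  have : FiniteDimensional ℝ (TangentSpace 𝓘(ℝ, E) (i p)) :=
    inferInstanceAs (FiniteDimensional ℝ E)
  have hle : LinearMap.range (di (E := E) (E' := E') i p) ≤ LinearMap.ker f := by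
    rintro _ ⟨u, rfl⟩
    exact hξN.ξ_inner_di hp u
  have hr : Module.finrank ℝ (LinearMap.range (di (E := E) (E' := E') i p)) =
      Module.finrank ℝ E' := LinearMap.finrank_range_of_inj (hi.injective p)
  have hf : f ≠ 0 := fun h ↦ by
    have h1 := congr($h (N p))
    have h2 : f (N p) = 1 := (g.symm _ _ _).trans (hξN.N_ξ p hp)
    rw [h2] at h1
    simp at h1
  have hk : Module.finrank ℝ (LinearMap.ker f) + 1 = Module.finrank ℝ E :=
    Module.Dual.finrank_ker_add_one_of_ne_zero hf
  rw [Submodule.eq_of_le_of_finrank_eq hle (by omega), LinearMap.mem_ker, g.symm]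
  rfl

lemma exists_di_eq_sub (hdim : Module.finrank ℝ E' + 1 = Module.finrank ℝ E)
    (hi : IsLightlike (E' := E') g i) (hξN : IsNormalizingPair g i S 𝒰 ξ N) (hp : p ∈ 𝒰)
    (w : TangentSpace 𝓘(ℝ, E) (i p)) :
    ∃ u, di (E' := E') i p u = w - g.inner (i p) w (di i p (ξ p)) • N p := by
  refine (mem_range_di_iff hdim hi hξN hp _).2 ?_
  rw [map_sub, sub_apply, map_smul, smul_apply, hξN.N_ξ p hp]
  simp

lemma isCompl_range_di_tr (hdim : Module.finrank ℝ E' + 1 = Module.finrank ℝ E)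
    (hi : IsLightlike (E' := E') g i) (hξN : IsNormalizingPair g i S 𝒰 ξ N) (hp : p ∈ 𝒰) :
    IsCompl (LinearMap.range (di (E := E) (E' := E') i p)) (tr i N p) := by
  refine ⟨Submodule.disjoint_def.2 ?_, codisjoint_iff_le_sup.2 fun w _ ↦ ?_⟩
  · intro w h1 h2
    obtain ⟨c, rfl⟩ := Submodule.mem_span_singleton.1 h2
    rw [mem_range_di_iff hdim hi hξN hp, map_smul, smul_apply, hξN.N_ξ p hp] at h1
    simp_all
  · obtain ⟨u, hu⟩ := exists_di_eq_sub hdim hi hξN hp w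
    exact Submodule.mem_sup.2 ⟨_, ⟨u, rfl⟩, _, Submodule.smul_mem _ _
      (Submodule.mem_span_singleton_self (N p)), by rw [hu]; exact sub_add_cancel _ _⟩

lemma di_tangentPart (hdim : Module.finrank ℝ E' + 1 = Module.finrank ℝ E)
    (hi : IsLightlike (E' := E') g i) (hξN : IsNormalizingPair g i S 𝒰 ξ N) (hp : p ∈ 𝒰)
    (w : TangentSpace 𝓘(ℝ, E) (i p)) :
    di (E' := E') i p (tangentPart i N p w) = w - g.inner (i p) w (di i p (ξ p)) • N p := by
  obtain ⟨u, hu⟩ := exists_di_eq_sub hdim hi hξN hp w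
  have hc := isCompl_range_di_tr hdim hi hξN hp
  have hw : w = di i p u + g.inner (i p) w (di i p (ξ p)) • N p := by rw [hu, sub_add_cancel]
  have h : tangentPart (E' := E') i N p w = u := by
    rw [tangentPart, dif_pos ⟨hi.injective p, hc⟩]
    conv_lhs => rw [hw]
    rw [map_add, LinearMap.linearProjOfIsCompl_apply_left,
      LinearMap.linearProjOfIsCompl_apply_right' (q := tr i N p) _ _ _ _
        (Submodule.smul_mem _ _ (Submodule.mem_span_singleton_self (N p))), add_zero]
  rw [h, hu]

/-- The Gauss formula. -/
lemma di_inducedCov (hdim : Module.finrank ℝ E' + 1 = Module.finrank ℝ E)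
    (hi : IsLightlike (E' := E') g i) (hξN : IsNormalizingPair g i S 𝒰 ξ N) (hp : p ∈ 𝒰)
    (X Y : Π p : M, TangentSpace 𝓘(ℝ, E') p) :
    di i p (inducedCov cov i N X Y p) = ambientCov cov i X Y p - B g cov i ξ N X Y p • N p := by
  rw [inducedCov, di_tangentPart hdim hi hξN hp, B_eq hξN hp]

/-- A radical vector annihilated by `η` is orthogonal to `T M` and to `N`, hence to all of
`T Mb`. -/
lemma eq_zero_of_mem_radical_of_η_eq_zero (hdim : Module.finrank ℝ E' + 1 = Module.finrank ℝ E)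
    (hi : IsLightlike (E' := E') g i) (hξN : IsNormalizingPair g i S 𝒰 ξ N) (hp : p ∈ 𝒰)
    {u : TangentSpace 𝓘(ℝ, E') p} (hu : u ∈ radical g i p) (hη : η g i N p u = 0) : u = 0 := by
  refine (map_eq_zero_iff (di i p) (hi.injective p)).1 (g.nondegenerate _ _ fun w ↦ ?_)
  obtain ⟨u', hu'⟩ := exists_di_eq_sub hdim hi hξN hp w
  rw [eq_sub_iff_add_eq] at hu'
  have h1 : g.inner (i p) (di i p u) (di i p u') = 0 := hu u'
  have h2 : g.inner (i p) (di i p u) (N p) = 0 := (g.symm _ _ _).trans hη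
  rw [← hu', map_add, map_smul, h1, h2, smul_zero, add_zero]

lemma eq_smul_ξ_of_mem_radical (hdim : Module.finrank ℝ E' + 1 = Module.finrank ℝ E)
    (hi : IsLightlike (E' := E') g i) (hξN : IsNormalizingPair g i S 𝒰 ξ N) (hp : p ∈ 𝒰)
    {u : TangentSpace 𝓘(ℝ, E') p} (hu : u ∈ radical g i p) : u = η g i N p u • ξ p := by
  refine sub_eq_zero.1 (eq_zero_of_mem_radical_of_η_eq_zero hdim hi hξN hp
    (sub_mem hu (Submodule.smul_mem _ _ (hξN.ξ_mem p hp))) ?_)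
  have h : g.inner (i p) (N p) (di i p (ξ p)) = 1 := hξN.N_ξ p hp
  simp only [η, map_sub, map_smul, h]
  simp

lemma flat_injective (hdim : Module.finrank ℝ E' + 1 = Module.finrank ℝ E)
    (hi : IsLightlike (E' := E') g i) (hξN : IsNormalizingPair g i S 𝒰 ξ N) (hp : p ∈ 𝒰) :
    Function.Injective (flat (E' := E') g i N p) := by
  intro u u' h
  have h1 (v) : inducedMetric g i p u v + η g i N p u * η g i N p v =
    inducedMetric g i p u' v + η g i N p u' * η g i N p v := congr($h v)
  have hη : η g i N p u = η g i N p u' := by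
    have h2 : η g i N p (ξ p) = 1 := hξN.N_ξ p hp
    simpa [h2, inducedMetric, hξN.di_inner_ξ hp] using h1 (ξ p)
  refine sub_eq_zero.1 (eq_zero_of_mem_radical_of_η_eq_zero hdim hi hξN hp (fun v ↦ ?_) ?_)
  · have h3 := h1 v
    rw [hη] at h3
    simpa [inducedMetric, sub_eq_zero] using h3
  · simpa [η, sub_eq_zero] using hη

/-- Every tangent vector is the sum of its screen part and `η(u) ξ`. -/
lemma screenProj_mem_and_sub (hdim : Module.finrank ℝ E' + 1 = Module.finrank ℝ E)
    (hi : IsLightlike (E' := E') g i) (hS : IsScreen g i S)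
    (hξN : IsNormalizingPair g i S 𝒰 ξ N) (hp : p ∈ 𝒰) (u : TangentSpace 𝓘(ℝ, E') p) :
    screenProj g i S p u ∈ S p ∧ u - screenProj g i S p u = η g i N p u • ξ p := by
  obtain ⟨a, ha, c, hc, h⟩ := Submodule.mem_sup.1
    ((hS.isCompl p).sup_eq_top.ge (Submodule.mem_top (x := u)))
  have h1 : screenProj g i S p u = a := projAlong_eq (hS.isCompl p) ha hc h.symm
  have h2 : η g i N p a = 0 := hξN.N_screen p hp a ha
  have h3 : η g i N p u = η g i N p c := by
    rw [← h]
    simpa [η] using h2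
  rw [h1, ← h, add_sub_cancel_left, h, h3]
  exact ⟨ha, eq_smul_ξ_of_mem_radical hdim hi hξN hp hc⟩

lemma φ_eq (hdim : Module.finrank ℝ E' + 1 = Module.finrank ℝ E)
    (hi : IsLightlike (E' := E') g i) (hS : IsScreen g i S)
    (hξN : IsNormalizingPair g i S 𝒰 ξ N) (hp : p ∈ 𝒰) (X : Π p : M, TangentSpace 𝓘(ℝ, E') p) :
    φ g cov i S ξ N X p = η g i N p (inducedCov cov i N X ξ p) := by
  rw [φ, (screenProj_mem_and_sub hdim hi hS hξN hp _).2, g.symm, map_smul, map_smul,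
    hξN.N_ξ p hp]
  simp

lemma inducedCov_ξ (hdim : Module.finrank ℝ E' + 1 = Module.finrank ℝ E)
    (hi : IsLightlike (E' := E') g i) (hS : IsScreen g i S)
    (hξN : IsNormalizingPair g i S 𝒰 ξ N) (hp : p ∈ 𝒰) (X : Π p : M, TangentSpace 𝓘(ℝ, E') p) :
    inducedCov cov i N X ξ p =
      -shapeScreen g cov i S ξ N X p + φ g cov i S ξ N X p • ξ p := by
  rw [shapeScreen, φ_eq hdim hi hS hξN hp, ← (screenProj_mem_and_sub hdim hi hS hξN hp _).2]
  abel

end Transversal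

/-! ### The tensors `θ₀`, `σ` and `F` at a point -/

section AlmostContact

lemma V_spec (hi : IsLightlike (E' := E') g i) (hξN : IsNormalizingPair g i S 𝒰 ξ N)
    (hJS : IsAdaptedScreen g J i S N 𝒰) (hp : p ∈ 𝒰) :
    V J i ξ p ∈ S p ∧ di i p (V J i ξ p) = -J.toFun (i p) (di i p (ξ p)) := by
  obtain ⟨s, hs, h⟩ := hJS.exists_screen hp (Submodule.mem_sup_left (hξN.ξ_mem p hp))
  have h1 : di i p (V J i ξ p) = -J.toFun (i p) (di i p (ξ p)) := di_toTangent ⟨s, h⟩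
  exact ⟨hi.injective p (h.trans h1.symm) ▸ hs, h1⟩

lemma θ₀_apply (hg : IsHermitian g J) (hi : IsLightlike (E' := E') g i)
    (hξN : IsNormalizingPair g i S 𝒰 ξ N)
    (hJS : IsAdaptedScreen g J i S N 𝒰) (hp : p ∈ 𝒰) (u : TangentSpace 𝓘(ℝ, E') p) :
    θ₀ g J i ξ p u = g.inner (i p) (J.toFun (i p) (di i p u)) (di i p (ξ p)) := by
  change g.inner (i p) _ _ = _
  rw [(V_spec hi hξN hJS hp).2, hg.inner_J_left, map_neg]

lemma θ₀_U (hg : IsHermitian g J) (hi : IsLightlike (E' := E') g i)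
    (hξN : IsNormalizingPair g i S 𝒰 ξ N)
    (hJS : IsAdaptedScreen g J i S N 𝒰) (hp : p ∈ 𝒰) :
    θ₀ g J i ξ p (U J i N p) = 1 := by
  rw [θ₀_apply hg hi hξN hJS hp, (U_spec hi hJS hp).2, map_neg, J.sq, neg_neg, hξN.N_ξ p hp]

lemma θ₀_V (hg : IsHermitian g J) (hi : IsLightlike (E' := E') g i)
    (hξN : IsNormalizingPair g i S 𝒰 ξ N) (hJS : IsAdaptedScreen g J i S N 𝒰) (hp : p ∈ 𝒰) :
    θ₀ g J i ξ p (V J i ξ p) = 0 := by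
  rw [θ₀_apply hg hi hξN hJS hp, (V_spec hi hξN hJS hp).2, map_neg, J.sq, neg_neg,
    hξN.di_inner_ξ hp]

variable [FiniteDimensional ℝ E]

lemma θ₀Sharp_eq_V (hdim : Module.finrank ℝ E' + 1 = Module.finrank ℝ E)
    (hi : IsLightlike (E' := E') g i) (hξN : IsNormalizingPair g i S 𝒰 ξ N)
    (hJS : IsAdaptedScreen g J i S N 𝒰) (hp : p ∈ 𝒰) :
    θ₀Sharp g J i ξ N p = V J i ξ p := by
  have h : flat (E' := E') g i N p (V J i ξ p) = θ₀ g J i ξ p := by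
    ext v
    have h0 : η g i N p (V J i ξ p) = 0 := hξN.N_screen p hp _ (V_spec hi hξN hJS hp).1
    change inducedMetric g i p _ v + η g i N p _ * η g i N p v = inducedMetric g i p v _
    rw [h0, zero_mul, add_zero]
    exact g.symm _ _ _
  rw [θ₀Sharp, sharp, ← h]
  exact Function.leftInverse_invFun (flat_injective hdim hi hξN hp) _

lemma mem_JRadical_iff (hdim : Module.finrank ℝ E' + 1 = Module.finrank ℝ E)
    (hi : IsLightlike (E' := E') g i) (hξN : IsNormalizingPair g i S 𝒰 ξ N)
    (hJS : IsAdaptedScreen g J i S N 𝒰) (hp : p ∈ 𝒰) (u : TangentSpace 𝓘(ℝ, E') p) :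
    u ∈ JRadical g J i p ↔ ∃ c : ℝ, u = c • V J i ξ p := by
  constructor
  · rintro ⟨w, hw, h⟩
    obtain ⟨r, rfl⟩ := hi.normal_le p hw
    have hr := eq_smul_ξ_of_mem_radical hdim hi hξN hp (u := r) hw
    refine ⟨-η g i N p r, hi.injective p ?_⟩
    rw [← h, map_smul, (V_spec hi hξN hJS hp).2]
    conv_lhs => rw [hr]
    simp
  · rintro ⟨c, rfl⟩
    refine ⟨di i p (-c • ξ p), Submodule.smul_mem _ _ (hξN.ξ_mem p hp), ?_⟩
    simp [(V_spec hi hξN hJS hp).2]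

/-- The distribution `Δ` is the kernel of `θ₀`. -/
lemma mem_Delta_iff (hdim : Module.finrank ℝ E' + 1 = Module.finrank ℝ E) (hg : IsHermitian g J)
    (hi : IsLightlike (E' := E') g i) (hS : IsScreen g i S)
    (hξN : IsNormalizingPair g i S 𝒰 ξ N)
    (hJS : IsAdaptedScreen g J i S N 𝒰) (hp : p ∈ 𝒰) (u : TangentSpace 𝓘(ℝ, E') p) :
    u ∈ Delta g J i S N p ↔ θ₀ g J i ξ p u = 0 := by
  have hV := V_spec hi hξN hJS hp
  have hθξ : θ₀ g J i ξ p (ξ p) = 0 := hξN.ξ_inner_di hp _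
  constructor
  · suffices h : Delta g J i S N p ≤ LinearMap.ker (θ₀ g J i ξ p) from fun hu ↦ h hu
    refine sup_le (sup_le ?_ ?_) ?_
    · intro u hu
      obtain ⟨c, rfl⟩ := (mem_JRadical_iff hdim hi hξN hJS hp u).1 hu
      rw [LinearMap.mem_ker, map_smul, θ₀_V hg hi hξN hJS hp, smul_zero]
    · exact fun u hu ↦ hu _
    · exact fun u hu ↦ hu.2 _ (Submodule.mem_sup_left
        ((mem_JRadical_iff hdim hi hξN hJS hp _).2 ⟨1, (one_smul _ _).symm⟩))
  · intro hu
    obtain ⟨h1, h2⟩ := screenProj_mem_and_sub hdim hi hS hξN hp u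
    set s := screenProj g i S p u
    have hs : θ₀ g J i ξ p s = 0 := by
      rw [sub_eq_iff_eq_add] at h2
      rw [h2, map_add, map_smul, hθξ] at hu
      simpa using hu
    -- Since `g₀(V, U) = 1` and `g₀(V, V) = 0`, subtracting `g₀(s, U) V` from the screen part `s`
    -- makes it orthogonal to `U` and keeps it orthogonal to `V`.
    set c := inducedMetric g i p s (U J i N p) with hc
    have hd : s - c • V J i ξ p ∈ D₀ g J i S N p := by
      refine ⟨sub_mem h1 (Submodule.smul_mem _ _ hV.1), fun w hw ↦ ?_⟩
      obtain ⟨a, ha, b, hb, rfl⟩ := Submodule.mem_sup.1 hw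
      obtain ⟨a, rfl⟩ := (mem_JRadical_iff hdim hi hξN hJS hp _).1 ha
      obtain ⟨b, rfl⟩ := (mem_JTr_iff hi hJS hp _).1 hb
      have e1 : g.inner (i p) (di i p s) (di i p (V J i ξ p)) = 0 := hs
      have e2 : g.inner (i p) (di i p (V J i ξ p)) (di i p (V J i ξ p)) = 0 :=
        θ₀_V hg hi hξN hJS hp
      have e3 : g.inner (i p) (di i p (V J i ξ p)) (di i p (U J i N p)) = 1 :=
        (g.symm _ _ _).trans (θ₀_U hg hi hξN hJS hp)
      simp only [inducedMetric] at hc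
      simp only [inducedMetric, map_sub, map_add, map_smul, sub_apply, smul_apply, e1, e2, e3,
        ← hc, smul_eq_mul]
      ring
    have h3 : u = c • V J i ξ p + η g i N p u • ξ p + (s - c • V J i ξ p) := by
      rw [← h2]
      abel
    rw [h3]
    exact Submodule.add_mem_sup (Submodule.add_mem_sup
      ((mem_JRadical_iff hdim hi hξN hJS hp _).2 ⟨c, rfl⟩)
      (Submodule.smul_mem _ _ (hξN.ξ_mem p hp))) hd

lemma isCompl_Delta_JTr (hdim : Module.finrank ℝ E' + 1 = Module.finrank ℝ E)
    (hg : IsHermitian g J) (hi : IsLightlike (E' := E') g i) (hS : IsScreen g i S)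
    (hξN : IsNormalizingPair g i S 𝒰 ξ N) (hJS : IsAdaptedScreen g J i S N 𝒰) (hp : p ∈ 𝒰) :
    IsCompl (Delta g J i S N p) (JTr (E' := E') J i N p) := by
  refine ⟨Submodule.disjoint_def.2 ?_, codisjoint_iff_le_sup.2 fun u _ ↦ ?_⟩
  · intro u h1 h2
    obtain ⟨c, rfl⟩ := (mem_JTr_iff hi hJS hp _).1 h2
    rw [mem_Delta_iff hdim hg hi hS hξN hJS hp, map_smul, θ₀_U hg hi hξN hJS hp] at h1
    simp_all
  · refine Submodule.mem_sup.2 ⟨u - θ₀ g J i ξ p u • U J i N p,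
      (mem_Delta_iff hdim hg hi hS hξN hJS hp _).2 ?_, _,
      (mem_JTr_iff hi hJS hp _).2 ⟨_, rfl⟩, sub_add_cancel _ _⟩
    rw [map_sub, map_smul, θ₀_U hg hi hξN hJS hp]
    simp

lemma σ_apply (hdim : Module.finrank ℝ E' + 1 = Module.finrank ℝ E)
    (hg : IsHermitian g J) (hi : IsLightlike (E' := E') g i) (hS : IsScreen g i S)
    (hξN : IsNormalizingPair g i S 𝒰 ξ N) (hJS : IsAdaptedScreen g J i S N 𝒰) (hp : p ∈ 𝒰)
    (u : TangentSpace 𝓘(ℝ, E') p) :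
    σ g J i S N p u = u - θ₀ g J i ξ p u • U J i N p := by
  refine projAlong_eq (isCompl_Delta_JTr hdim hg hi hS hξN hJS hp)
    ((mem_Delta_iff hdim hg hi hS hξN hJS hp _).2 ?_)
    ((mem_JTr_iff hi hJS hp _).2 ⟨_, rfl⟩) (sub_add_cancel _ _).symm
  rw [map_sub, map_smul, θ₀_U hg hi hξN hJS hp]
  simp

/-- The decomposition `J u = F u + θ₀(u) N` of `J u` into its tangential and transversal parts. -/
lemma di_F (hdim : Module.finrank ℝ E' + 1 = Module.finrank ℝ E)
    (hg : IsHermitian g J) (hi : IsLightlike (E' := E') g i) (hS : IsScreen g i S)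
    (hξN : IsNormalizingPair g i S 𝒰 ξ N) (hJS : IsAdaptedScreen g J i S N 𝒰) (hp : p ∈ 𝒰)
    (u : TangentSpace 𝓘(ℝ, E') p) :
    di i p (F g J i S N p u) = J.toFun (i p) (di i p u) - θ₀ g J i ξ p u • N p := by
  have h : J.toFun (i p) (di i p (σ g J i S N p u)) =
      J.toFun (i p) (di i p u) - θ₀ g J i ξ p u • N p := by
    rw [σ_apply hdim hg hi hS hξN hJS hp, map_sub, map_smul, (U_spec hi hJS hp).2, map_sub,
      map_smul, map_neg, J.sq, neg_neg]
  rw [F, h, di_toTangent]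
  rw [mem_range_di_iff hdim hi hξN hp, map_sub, sub_apply, map_smul, smul_apply, hξN.N_ξ p hp,
    ← θ₀_apply hg hi hξN hJS hp]
  simp

end AlmostContact

end Pointwise

/-! ### The structure equations -/

section Derivatives

variable {E : Type*} [NormedAddCommGroup E] [NormedSpace ℝ E]
  {Mb : Type*} [TopologicalSpace Mb] [ChartedSpace E Mb] [IsManifold 𝓘(ℝ, E) ∞ Mb]
  {E' : Type*} [NormedAddCommGroup E'] [NormedSpace ℝ E']
  {M : Type*} [TopologicalSpace M] [ChartedSpace E' M]
  {g : PseudoRiemannianMetric E Mb} {J : AlmostComplexStructure E Mb}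
  {cov : CovariantDerivative 𝓘(ℝ, E) E (TangentSpace 𝓘(ℝ, E) : Mb → Type _)}
  {i : M → Mb} {S : Π p : M, Submodule ℝ (TangentSpace 𝓘(ℝ, E') p)} {𝒰 : Set M}
  {ξ : Π p : M, TangentSpace 𝓘(ℝ, E') p} {N : Π p : M, TangentSpace 𝓘(ℝ, E) (i p)} {p : M}
  {X Y : Π p : M, TangentSpace 𝓘(ℝ, E') p}

lemma SmoothFieldAlong.mdiffAlong (h𝒰 : IsOpen 𝒰) (hN : SmoothFieldAlong (E' := E') i 𝒰 N)
    (hp : p ∈ 𝒰) : MDiffAlong (E' := E') i N p :=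
  ((hN p hp).contMDiffAt (h𝒰.mem_nhds hp)).mdifferentiableAt (by simp)

lemma ambientCov_of_eventually_eq_neg_J [FiniteDimensional ℝ E] (hJ : IsParallel cov J)
    {W : Π p : M, TangentSpace 𝓘(ℝ, E) (i p)} (hW : MDiffAlong (E' := E') i W p)
    (h : ∀ᶠ q in 𝓝 p, di i q (Y q) = -J.toFun (i q) (W q)) :
    ambientCov cov i X Y p = -J.toFun (i p) (covAlong cov i W p (X p)) := by
  rw [ambientCov, covAlong_congr (Z := fun q ↦ -J.toFun (i q) (W q)) _ _ _ h,
    covAlong_neg _ _ (hW.complexStructure J), covAlong_J _ hJ hW]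

variable [IsManifold 𝓘(ℝ, E') ∞ M]

lemma SmoothField.mdiffAlong_di (hi : IsLightlike (E' := E') g i) (h𝒰 : IsOpen 𝒰)
    (hY : SmoothField 𝒰 Y) (hp : p ∈ 𝒰) :
    MDiffAlong (E' := E') i (fun q ↦ di (E := E) i q (Y q)) p := by
  have h1 : ContMDiffAt 𝓘(ℝ, E').tangent 𝓘(ℝ, E).tangent ∞
      (tangentMap 𝓘(ℝ, E') 𝓘(ℝ, E) i) (⟨p, Y p⟩ : TangentBundle 𝓘(ℝ, E') M) :=
    (hi.contMDiff.contMDiff_tangentMap (by simp)).contMDiffAt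
  have h2 := (hY p hp).contMDiffAt (h𝒰.mem_nhds hp)
  exact (h1.comp p h2).mdifferentiableAt (by simp)

lemma mdifferentiableAt_θ₀ (hg : IsHermitian g J) (hi : IsLightlike (E' := E') g i)
    (h𝒰 : IsOpen 𝒰) (hξN : IsNormalizingPair g i S 𝒰 ξ N) (hJS : IsAdaptedScreen g J i S N 𝒰)
    (hp : p ∈ 𝒰) (hY : SmoothField 𝒰 Y) :
    MDifferentiableAt 𝓘(ℝ, E') 𝓘(ℝ, ℝ) (fun q ↦ θ₀ g J i ξ q (Y q)) p :=
  (((hY.mdiffAlong_di hi h𝒰 hp).complexStructure J).inner g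
    (hξN.smooth_ξ.mdiffAlong_di hi h𝒰 hp)).congr_of_eventuallyEq
    ((h𝒰.eventually_mem hp).mono fun _ hq ↦ θ₀_apply hg hi hξN hJS hq _)

/-- `J N` is tangent to the hypersurface. -/
lemma inner_J_N_ξ (hi : IsLightlike (E' := E') g i) (hξN : IsNormalizingPair g i S 𝒰 ξ N)
    (hJS : IsAdaptedScreen g J i S N 𝒰) (hp : p ∈ 𝒰) :
    g.inner (i p) (J.toFun (i p) (N p)) (di i p (ξ p)) = 0 := by
  have h := hξN.di_inner_ξ hp (U J i N p)
  rw [(U_spec hi hJS hp).2, map_neg, neg_apply] at h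
  exact neg_eq_zero.1 h

variable [FiniteDimensional ℝ E]

/-- Differentiating `g(Y, ξ) = 0` for `Y` tangent to the hypersurface. -/
lemma inner_ambientCov_ξ (hg : IsLeviCivita g cov) (hi : IsLightlike (E' := E') g i)
    (h𝒰 : IsOpen 𝒰) (hξN : IsNormalizingPair g i S 𝒰 ξ N) (hp : p ∈ 𝒰)
    (hY : MDiffAlong (E' := E') i (fun q ↦ di (E := E) i q (Y q)) p) :
    g.inner (i p) (ambientCov cov i X Y p) (di i p (ξ p)) =
      -g.inner (i p) (di i p (Y p)) (ambientCov cov i X ξ p) := by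
  have hξ := hξN.smooth_ξ.mdiffAlong_di hi h𝒰 hp
  have h := mvfderiv_inner (X p) hg hY hξ
  rw [mvfderiv_congr (h := fun _ ↦ (0 : ℝ)) (X p) ((h𝒰.eventually_mem hp).mono fun q hq ↦
    hξN.di_inner_ξ hq (Y q)), mvfderiv_const] at h
  exact eq_neg_of_add_eq_zero_left h.symm

/-- As `ξ` is null, `∇̄_X ξ` is tangent to the hypersurface. -/
lemma B_ξ (hg : IsLeviCivita g cov) (hi : IsLightlike (E' := E') g i)
    (h𝒰 : IsOpen 𝒰) (hξN : IsNormalizingPair g i S 𝒰 ξ N) (hp : p ∈ 𝒰) :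
    B g cov i ξ N X ξ p = 0 := by
  rw [B_eq hξN hp]
  have h := inner_ambientCov_ξ (X := X) hg hi h𝒰 hξN hp (hξN.smooth_ξ.mdiffAlong_di hi h𝒰 hp)
  have h1 := g.symm (i p) (di i p (ξ p)) (ambientCov cov i X ξ p)
  linarith

lemma di_inducedCov_ξ (hdim : Module.finrank ℝ E' + 1 = Module.finrank ℝ E)
    (hg : IsLeviCivita g cov) (hi : IsLightlike (E' := E') g i)
    (h𝒰 : IsOpen 𝒰) (hξN : IsNormalizingPair g i S 𝒰 ξ N) (hp : p ∈ 𝒰) :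
    di i p (inducedCov cov i N X ξ p) = ambientCov cov i X ξ p := by
  rw [di_inducedCov hdim hi hξN hp, B_ξ hg hi h𝒰 hξN hp, zero_smul, sub_zero]

/-- The Weingarten formula, with transversal part written as `-φ(X) N`, obtained by differentiating
`g(N, ξ) = 1`. -/
lemma weingarten (hdim : Module.finrank ℝ E' + 1 = Module.finrank ℝ E)
    (hg : IsLeviCivita g cov) (hi : IsLightlike (E' := E') g i) (hS : IsScreen g i S)
    (h𝒰 : IsOpen 𝒰) (hξN : IsNormalizingPair g i S 𝒰 ξ N) (hp : p ∈ 𝒰) :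
    g.inner (i p) (covAlong cov i N p (X p)) (di i p (ξ p)) = -φ g cov i S ξ N X p ∧
    covAlong cov i N p (X p) =
      -di i p (shapeN cov i N X p) - φ g cov i S ξ N X p • N p := by
  have hN := hξN.smooth_N.mdiffAlong h𝒰 hp
  have h := mvfderiv_inner (X p) hg hN (hξN.smooth_ξ.mdiffAlong_di hi h𝒰 hp)
  rw [mvfderiv_congr (h := fun _ ↦ (1 : ℝ)) (X p) ((h𝒰.eventually_mem hp).mono fun q hq ↦
    hξN.N_ξ q hq), mvfderiv_const] at h
  have h1 : g.inner (i p) (covAlong cov i N p (X p)) (di i p (ξ p)) =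
      -φ g cov i S ξ N X p := by
    rw [φ_eq hdim hi hS hξN hp, η, di_inducedCov_ξ hdim hg hi h𝒰 hξN hp]
    exact eq_neg_of_add_eq_zero_left h.symm
  refine ⟨h1, ?_⟩
  rw [shapeN, map_neg, di_tangentPart hdim hi hξN hp, h1]
  module

/-- `F Y`, viewed along `i`, is `J Y - θ₀(Y) N` near `p`. -/
lemma eventually_di_F (hdim : Module.finrank ℝ E' + 1 = Module.finrank ℝ E)
    (hg : IsHermitian g J) (hi : IsLightlike (E' := E') g i) (hS : IsScreen g i S)
    (h𝒰 : IsOpen 𝒰) (hξN : IsNormalizingPair g i S 𝒰 ξ N) (hJS : IsAdaptedScreen g J i S N 𝒰)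
    (hp : p ∈ 𝒰) (Y : Π p : M, TangentSpace 𝓘(ℝ, E') p) :
    ∀ᶠ q in 𝓝 p, J.toFun (i q) (di i q (Y q)) =
      di i q (F g J i S N q (Y q)) + θ₀ g J i ξ q (Y q) • N q :=
  (h𝒰.eventually_mem hp).mono fun q hq ↦ by
    rw [di_F hdim hg hi hS hξN hJS hq, sub_add_cancel]

lemma mdiffAlong_di_F (hdim : Module.finrank ℝ E' + 1 = Module.finrank ℝ E)
    (hg : IsHermitian g J) (hi : IsLightlike (E' := E') g i) (hS : IsScreen g i S)
    (h𝒰 : IsOpen 𝒰) (hξN : IsNormalizingPair g i S 𝒰 ξ N) (hJS : IsAdaptedScreen g J i S N 𝒰)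
    (hp : p ∈ 𝒰) (hY : SmoothField 𝒰 Y) :
    MDiffAlong (E' := E') i (fun q ↦ di (E := E) i q (F g J i S N q (Y q))) p := by
  refine (((hY.mdiffAlong_di hi h𝒰 hp).complexStructure J).add
    (MDiffAlong.smul (mdifferentiableAt_θ₀ hg hi h𝒰 hξN hJS hp hY).neg
      (hξN.smooth_N.mdiffAlong h𝒰 hp))).congr ?_
  filter_upwards [h𝒰.eventually_mem hp] with q hq
  rw [di_F hdim hg hi hS hξN hJS hq, Pi.neg_apply, neg_smul, sub_eq_add_neg]

lemma θ₀_inducedCov (hdim : Module.finrank ℝ E' + 1 = Module.finrank ℝ E)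
    (hg : IsHermitian g J) (hi : IsLightlike (E' := E') g i)
    (hξN : IsNormalizingPair g i S 𝒰 ξ N) (hJS : IsAdaptedScreen g J i S N 𝒰) (hp : p ∈ 𝒰) :
    θ₀ g J i ξ p (inducedCov cov i N X Y p) =
      g.inner (i p) (J.toFun (i p) (ambientCov cov i X Y p)) (di i p (ξ p)) := by
  rw [θ₀_apply hg hi hξN hJS hp, di_inducedCov hdim hi hξN hp, map_sub, map_sub, sub_apply,
    map_smul, map_smul, smul_apply, inner_J_N_ξ hi hξN hJS hp, smul_zero, sub_zero]

lemma ambientCov_U (hJ : IsParallel cov J) (hi : IsLightlike (E' := E') g i)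
    (h𝒰 : IsOpen 𝒰) (hξN : IsNormalizingPair g i S 𝒰 ξ N) (hJS : IsAdaptedScreen g J i S N 𝒰)
    (hp : p ∈ 𝒰) :
    ambientCov cov i X (U J i N) p = -J.toFun (i p) (covAlong cov i N p (X p)) :=
  ambientCov_of_eventually_eq_neg_J hJ (hξN.smooth_N.mdiffAlong h𝒰 hp)
    ((h𝒰.eventually_mem hp).mono fun _ hq ↦ (U_spec hi hJS hq).2)

lemma ambientCov_θ₀Sharp (hdim : Module.finrank ℝ E' + 1 = Module.finrank ℝ E)
    (hJ : IsParallel cov J) (hi : IsLightlike (E' := E') g i)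
    (h𝒰 : IsOpen 𝒰) (hξN : IsNormalizingPair g i S 𝒰 ξ N) (hJS : IsAdaptedScreen g J i S N 𝒰)
    (hp : p ∈ 𝒰) :
    ambientCov cov i X (θ₀Sharp g J i ξ N) p = -J.toFun (i p) (ambientCov cov i X ξ p) :=
  ambientCov_of_eventually_eq_neg_J hJ (hξN.smooth_ξ.mdiffAlong_di hi h𝒰 hp)
    ((h𝒰.eventually_mem hp).mono fun _ hq ↦ by
      rw [θ₀Sharp_eq_V hdim hi hξN hJS hq, (V_spec hi hξN hJS hq).2])

theorem covθ₀_eq (hdim : Module.finrank ℝ E' + 1 = Module.finrank ℝ E)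
    (hK : IsKahler g J cov) (hi : IsLightlike (E' := E') g i) (hS : IsScreen g i S)
    (h𝒰 : IsOpen 𝒰) (hξN : IsNormalizingPair g i S 𝒰 ξ N) (hJS : IsAdaptedScreen g J i S N 𝒰)
    (hp : p ∈ 𝒰) (hY : SmoothField 𝒰 Y) :
    covθ₀ g J cov i ξ N X Y p = θ₀ g J i ξ p (Y p) * φ g cov i S ξ N X p -
      B g cov i ξ N X (fun q ↦ F g J i S N q (Y q)) p := by
  have hJY := (hY.mdiffAlong_di hi h𝒰 hp).complexStructure J
  have hξ := hξN.smooth_ξ.mdiffAlong_di hi h𝒰 hp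
  rw [covθ₀, θ₀_inducedCov hdim hK.hermitian hi hξN hJS hp,
    mvfderiv_congr (h := fun q ↦ g.inner (i q) (J.toFun (i q) (di i q (Y q))) (di i q (ξ q))) (X p)
      ((h𝒰.eventually_mem hp).mono fun q hq ↦ θ₀_apply hK.hermitian hi hξN hJS hq _),
    mvfderiv_inner _ hK.leviCivita hJY hξ, covAlong_J _ hK.parallel (hY.mdiffAlong_di hi h𝒰 hp),
    (eventually_di_F hdim hK.hermitian hi hS h𝒰 hξN hJS hp Y).self_of_nhds, B_eq hξN hp,
    inner_ambientCov_ξ hK.leviCivita hi h𝒰 hξN hp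
      (mdiffAlong_di_F hdim hK.hermitian hi hS h𝒰 hξN hJS hp hY),
    φ_eq hdim hi hS hξN hp, η, di_inducedCov_ξ hdim hK.leviCivita hi h𝒰 hξN hp]
  simp only [map_add, map_smul, add_apply, smul_apply, smul_eq_mul, ambientCov]
  ring

theorem covF_eq (hdim : Module.finrank ℝ E' + 1 = Module.finrank ℝ E)
    (hK : IsKahler g J cov) (hi : IsLightlike (E' := E') g i) (hS : IsScreen g i S)
    (h𝒰 : IsOpen 𝒰) (hξN : IsNormalizingPair g i S 𝒰 ξ N) (hJS : IsAdaptedScreen g J i S N 𝒰)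
    (hp : p ∈ 𝒰) (hY : SmoothField 𝒰 Y) :
    covF g J cov i S N X Y p =
      θ₀ g J i ξ p (Y p) • shapeN cov i N X p - B g cov i ξ N X Y p • U J i N p := by
  have hdY := hY.mdiffAlong_di hi h𝒰 hp
  have hN := hξN.smooth_N.mdiffAlong h𝒰 hp
  have hθ := mdifferentiableAt_θ₀ hK.hermitian hi h𝒰 hξN hJS hp hY
  -- Differentiate `J Y = F Y + θ₀(Y) N`.
  have h1 := covAlong_congr _ _ cov (X p)
    (eventually_di_F hdim hK.hermitian hi hS h𝒰 hξN hJS hp Y)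
  rw [covAlong_J _ hK.parallel hdY, covAlong_add cov _
    (mdiffAlong_di_F hdim hK.hermitian hi hS h𝒰 hξN hJS hp hY) (MDiffAlong.smul hθ hN),
    covAlong_smul cov _ hθ hN, (weingarten hdim hK.leviCivita hi hS h𝒰 hξN hp).2] at h1
  have h2 := covθ₀_eq (X := X) hdim hK hi hS h𝒰 hξN hJS hp hY
  rw [covθ₀, sub_eq_iff_eq_add] at h2
  rw [h2] at h1
  refine hi.injective p ?_
  rw [covF, map_sub, map_sub, map_smul, map_smul, di_F hdim hK.hermitian hi hS hξN hJS hp,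
    di_inducedCov hdim hi hξN hp, di_inducedCov hdim hi hξN hp, (U_spec hi hJS hp).2, map_sub,
    map_smul, ambientCov, ambientCov, h1]
  module

theorem φ_eq_neg_θ₀ (hdim : Module.finrank ℝ E' + 1 = Module.finrank ℝ E)
    (hK : IsKahler g J cov) (hi : IsLightlike (E' := E') g i) (hS : IsScreen g i S)
    (h𝒰 : IsOpen 𝒰) (hξN : IsNormalizingPair g i S 𝒰 ξ N) (hJS : IsAdaptedScreen g J i S N 𝒰)
    (hp : p ∈ 𝒰) :
    φ g cov i S ξ N X p = -θ₀ g J i ξ p (inducedCov cov i N X (U J i N) p) := by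
  rw [θ₀_inducedCov hdim hK.hermitian hi hξN hJS hp, ambientCov_U hK.parallel hi h𝒰 hξN hJS hp,
    map_neg, J.sq, neg_neg, (weingarten hdim hK.leviCivita hi hS h𝒰 hξN hp).1, neg_neg]

theorem inducedCov_θ₀Sharp (hdim : Module.finrank ℝ E' + 1 = Module.finrank ℝ E)
    (hK : IsKahler g J cov) (hi : IsLightlike (E' := E') g i) (hS : IsScreen g i S)
    (h𝒰 : IsOpen 𝒰) (hξN : IsNormalizingPair g i S 𝒰 ξ N) (hJS : IsAdaptedScreen g J i S N 𝒰)
    (hp : p ∈ 𝒰) :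
    inducedCov cov i N X (θ₀Sharp g J i ξ N) p =
      F g J i S N p (shapeScreen g cov i S ξ N X p) +
        φ g cov i S ξ N X p • θ₀Sharp g J i ξ N p := by
  have hV := V_spec hi hξN hJS hp
  have h1 : ambientCov cov i X (θ₀Sharp g J i ξ N) p =
      di i p (F g J i S N p (shapeScreen g cov i S ξ N X p)) +
        θ₀ g J i ξ p (shapeScreen g cov i S ξ N X p) • N p +
        φ g cov i S ξ N X p • di i p (V J i ξ p) := by
    rw [ambientCov_θ₀Sharp hdim hK.parallel hi h𝒰 hξN hJS hp,
      ← di_inducedCov_ξ hdim hK.leviCivita hi h𝒰 hξN hp, inducedCov_ξ hdim hi hS hξN hp,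
      di_F hdim hK.hermitian hi hS hξN hJS hp, hV.2]
    simp only [map_add, map_neg, map_smul]
    module
  have h2 : B g cov i ξ N X (θ₀Sharp g J i ξ N) p =
      θ₀ g J i ξ p (shapeScreen g cov i S ξ N X p) := by
    rw [B_eq hξN hp, h1]
    simp only [map_add, map_smul, add_apply, smul_apply, hξN.di_inner_ξ hp, hξN.N_ξ p hp]
    simp
  refine hi.injective p ?_
  rw [di_inducedCov hdim hi hξN hp, h2, h1, θ₀Sharp_eq_V hdim hi hξN hJS hp, map_add, map_smul]
  abel

/-! ### Totally geodesic hypersurfaces -/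

section TotallyGeodesic

/-- For a totally geodesic hypersurface, `∇̄_X ξ` is orthogonal to the hypersurface. The
hypothesis is tested on a smooth local extension of each tangent vector `v`. -/
lemma IsTotallyGeodesic.inner_ambientCov_ξ_eq_zero
    (hT : IsTotallyGeodesic (E' := E') cov i) (hg : IsLeviCivita g cov)
    (hi : IsLightlike (E' := E') g i) (h𝒰 : IsOpen 𝒰) (hξN : IsNormalizingPair g i S 𝒰 ξ N)
    (hp : p ∈ 𝒰) (hX : SmoothField 𝒰 X) (v : TangentSpace 𝓘(ℝ, E') p) :
    g.inner (i p) (di i p v) (ambientCov cov i X ξ p) = 0 := by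
  obtain ⟨s, hs, hsm⟩ := FiberBundle.exists_contMDiffOn_extend (k := ∞) 𝓘(ℝ, E') E' v
  obtain ⟨t, hts, ht, hpt⟩ := mem_nhds_iff.1 hs
  have hZ : SmoothField (𝒰 ∩ t) (FiberBundle.extend E' v) := hsm.mono fun q hq ↦ hts hq.2
  have hpZ : p ∈ 𝒰 ∩ t := ⟨hp, hpt⟩
  obtain ⟨u, hu⟩ := hT (𝒰 ∩ t) X _ (h𝒰.inter ht) (hX.mono Set.inter_subset_left) hZ p hpZ
  have h := inner_ambientCov_ξ (X := X) hg hi h𝒰 hξN hp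
    (hZ.mdiffAlong_di hi (h𝒰.inter ht) hpZ)
  rw [← hu, hξN.di_inner_ξ hp, FiberBundle.extend_apply_self] at h
  exact neg_eq_zero.1 h.symm

lemma IsTotallyGeodesic.shapeScreen_eq_zero (hdim : Module.finrank ℝ E' + 1 = Module.finrank ℝ E)
    (hT : IsTotallyGeodesic (E' := E') cov i) (hg : IsLeviCivita g cov)
    (hi : IsLightlike (E' := E') g i) (hS : IsScreen g i S) (h𝒰 : IsOpen 𝒰)
    (hξN : IsNormalizingPair g i S 𝒰 ξ N) (hp : p ∈ 𝒰) (hX : SmoothField 𝒰 X) :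
    shapeScreen g cov i S ξ N X p = 0 := by
  have hr : inducedCov cov i N X ξ p ∈ radical g i p := fun v ↦ by
    rw [di_inducedCov_ξ hdim hg hi h𝒰 hξN hp, g.symm]
    exact hT.inner_ambientCov_ξ_eq_zero hg hi h𝒰 hξN hp hX v
  rw [shapeScreen, screenProj, projAlong_eq (hS.isCompl p) (zero_mem _) hr (zero_add _).symm,
    neg_zero]

end TotallyGeodesic

end Derivatives

end LightlikeKahler

theorem mainTheorem10
    {E : Type*} [NormedAddCommGroup E] [NormedSpace ℝ E] [FiniteDimensional ℝ E]
    {Mb : Type*} [TopologicalSpace Mb] [ChartedSpace E Mb] [IsManifold 𝓘(ℝ, E) ∞ Mb]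
    {E' : Type*} [NormedAddCommGroup E'] [NormedSpace ℝ E'] [FiniteDimensional ℝ E']
    {M : Type*} [TopologicalSpace M] [ChartedSpace E' M] [IsManifold 𝓘(ℝ, E') ∞ M]
    (m : ℕ) (hm : 1 < m)
    (hE : Module.finrank ℝ E = 2 * m) (hE' : Module.finrank ℝ E' + 1 = 2 * m)
    (g : PseudoRiemannianMetric E Mb)
    (J : AlmostComplexStructure E Mb)
    (cov : CovariantDerivative 𝓘(ℝ, E) E (TangentSpace 𝓘(ℝ, E) : Mb → Type _))
    (hK : IsKahler g J cov)
    (i : M → Mb) (hi : IsLightlike (E' := E') g i)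
    (S : Π p : M, Submodule ℝ (TangentSpace 𝓘(ℝ, E') p))
    (hS : IsScreen g i S)
    (𝒰 : Set M) (h𝒰 : IsOpen 𝒰)
    (ξ : Π p : M, TangentSpace 𝓘(ℝ, E') p) (N : Π p : M, TangentSpace 𝓘(ℝ, E) (i p))
    (hξN : IsNormalizingPair g i S 𝒰 ξ N)
    (hJS : IsAdaptedScreen g J i S N 𝒰) :
    (∀ X Y : Π p : M, TangentSpace 𝓘(ℝ, E') p,
      SmoothField 𝒰 X → SmoothField 𝒰 Y → ∀ p ∈ 𝒰,
        covθ₀ g J cov i ξ N X Y p =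
            θ₀ g J i ξ p (Y p) * φ g cov i S ξ N X p -
              B g cov i ξ N X (fun q ↦ F g J i S N q (Y q)) p ∧
        covF g J cov i S N X Y p =
            θ₀ g J i ξ p (Y p) • shapeN cov i N X p -
              B g cov i ξ N X Y p • U J i N p ∧
        φ g cov i S ξ N X p =
            -θ₀ g J i ξ p
              (inducedCov cov i N X (U J i N) p) ∧
        inducedCov cov i N X (θ₀Sharp g J i ξ N) p =
            F g J i S N p (shapeScreen g cov i S ξ N X p) +
              φ g cov i S ξ N X p • θ₀Sharp g J i ξ N p) ∧
    (IsTotallyGeodesic (E' := E') cov i →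
      ∀ X Y : Π p : M, TangentSpace 𝓘(ℝ, E') p,
        SmoothField 𝒰 X → SmoothField 𝒰 Y → ∀ p ∈ 𝒰,
          covθ₀ g J cov i ξ N X Y p =
              θ₀ g J i ξ p (Y p) * φ g cov i S ξ N X p ∧
          inducedCov cov i N X (θ₀Sharp g J i ξ N) p =
              φ g cov i S ξ N X p • θ₀Sharp g J i ξ N p) := by
  have hdim : Module.finrank ℝ E' + 1 = Module.finrank ℝ E := hE'.trans hE.symm
  refine ⟨fun X Y _ hY p hp ↦ ⟨covθ₀_eq hdim hK hi hS h𝒰 hξN hJS hp hY,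
    covF_eq hdim hK hi hS h𝒰 hξN hJS hp hY, φ_eq_neg_θ₀ hdim hK hi hS h𝒰 hξN hJS hp,
    inducedCov_θ₀Sharp hdim hK hi hS h𝒰 hξN hJS hp⟩, fun hT X Y hX hY p hp ↦ ⟨?_, ?_⟩⟩
  · rw [covθ₀_eq hdim hK hi hS h𝒰 hξN hJS hp hY, B_eq hξN hp,
      inner_ambientCov_ξ hK.leviCivita hi h𝒰 hξN hp
        (mdiffAlong_di_F hdim hK.hermitian hi hS h𝒰 hξN hJS hp hY),
      hT.inner_ambientCov_ξ_eq_zero hK.leviCivita hi h𝒰 hξN hp hX, neg_zero, sub_zero]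
  · have hF : F g J i S N p 0 = 0 := hi.injective p (by
      rw [di_F hdim hK.hermitian hi hS hξN hJS hp]
      simp)
    rw [inducedCov_θ₀Sharp hdim hK hi hS h𝒰 hξN hJS hp,
      hT.shapeScreen_eq_zero hdim hK.leviCivita hi hS h𝒰 hξN hp hX, hF, zero_add]
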